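/- An Orlicz N-function is a continuous even convex $\varphi:\mathbb R\to\mathbb R$, increasing on $(0,\infty)$, with $\varphi(0)=0$, $\varphi(x)/x\to0$ as $x\to0$ and $\varphi(x)/x\to\infty$ as $x\to\infty$. Let $\varphi$ be an Orlicz N-function such that $\lim_{x\to0}\varphi(x)/x^2$ exists in $(0,+\infty]$. On a probability space $(\Omega,\mathcal B,\mathbf P)$, $Sub_\varphi(\Omega)$ is the set of real zero-mean random variables $\xi$ for which there is $r\ge0$ with $\mathbf E e^{\lambda\xi}\le e^{\varphi(r\lambda)}$ for all $\lambda\in\mathbb R$, and $\tau_\varphi(\xi)$ is the infimum of all such $r$. Let $\mathbf X(t)$, $t\in\mathbb R$, be a random process with $\mathbf X(t)\in Sub_\varphi(\Omega)$ for all $t$ and $\sup_t\tau_\varphi(\mathbf X(t))<\infty$, continuous in the norm $\tau_\varphi$, i.e. $\tau_\varphi(\mathbf X(t)-\mathbf X(t_0))\to0$ as $t\to t_0$ for every $t_0$. Let $\widehat f(y)=\int_{\mathbb R}e^{-iyx}f(x)\,dx$. Let $\phi\in L_2(\mathbb R)$ be a continuous f-wavelet: $\widehat\phi(0)\ne0$,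 $\widehat\phi$ is continuous at $0$, $\sum_{k\in\mathbb Z}|\widehat\phi(y+2\pi k)|^2=1$ a.e., and there is a $2\pi$-periodic $m_0\in L_2([0,2\pi])$ with $\widehat\phi(y)=m_0(y/2)\widehat\phi(y/2)$ a.e. Let $\psi$ be the corresponding m-wavelet, i.e. the inverse Fourier transform of $\overline{m_0(y/2+\pi)}\,e^{-iy/2}\,\widehat\phi(y/2)$, and suppose that $\psi$ is continuous. Suppose there is a decreasing function $\Phi:[0,\infty)\to\mathbb R$ with $\int_{\mathbb R}\Phi(|x|)\,dx<\infty$ such that $|\phi(x)|\le\Phi(|x|)$ and $|\psi(x)|\le\Phi(|x|)$ for a.e. $x$. Let $c:\mathbb R\to\mathbb R$ be even, non-decreasing on $[0,\infty)$, with $c(0)>1$, and suppose there are $A:(0,\infty)\to(0,\infty)$ and $x_0\in\mathbb R$ with $c(ax)\le c(x)A(a)$ for all $a>0$ and $x\ge x_0$. Assume that $\int_{\mathbb R}c(x)\Phi(|x|)\,dx<\infty$ and $\tau_\varphi(\mathbf X(t))\le c(t)$ for all $t\in\mathbb R$. Put $\phi_{jk}(x)=2^{j/2}\phi(2^jx-k)$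 and $\psi_{jk}(x)=2^{j/2}\psi(2^jx-k)$. Then the mean-square integrals $\xi_{0k}=\int_{\mathbb R}\mathbf X(t)\overline{\phi_{0k}(t)}\,dt$ and $\eta_{jk}=\int_{\mathbb R}\mathbf X(t)\overline{\psi_{jk}(t)}\,dt$ (integrals of $L_2(\Omega)$-valued functions) exist for all $j\in\mathbb N_0$ and $k\in\mathbb Z$, and for the approximants, where $\mathbf k_n=(k_0',k_0,\dots,k_{n-1})$ consists of non-negative integers, $$\mathbf X_{n,\mathbf k_n}(t)=\sum_{|k|\le k_0'}\xi_{0k}\phi_{0k}(t)+\sum_{j=0}^{n-1}\sum_{|k|\le k_j}\eta_{jk}\psi_{jk}(t),\qquad t\in\mathbb R,$$ the following holds. 1. $\mathbf X_{n,\mathbf k_n}(t)\in L_2(\Omega)$ for all $n$, $\mathbf k_n$ and $t$. 2. For every $t\in\mathbb R$, $\mathbf X_{n,\mathbf k_n}(t)\to\mathbf X(t)$ in mean square as $n\to\infty$, $k_0'\to\infty$ and $k_j\to\infty$ for all $j\in\mathbb N_0$; that is, for every $\varepsilon>0$ there are $N$, $K'$ and $K_0,K_1,K_2,\dots$ in $\mathbb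 N_0$ such that $\mathbf E|\mathbf X_{n,\mathbf k_n}(t)-\mathbf X(t)|^2<\varepsilon$ whenever $n\ge N$, $k_0'\ge K'$ and $k_j\ge K_j$ for all $j<n$. -/

import Mathlib

open MeasureTheory ProbabilityTheory Filter Topology

noncomputable section

namespace SubPhiWavelet

/-- Orlicz N-functions. -/
structure IsOrliczNFunction (vphi : ℝ → ℝ) : Prop where
  continuous : Continuous vphi
  even : ∀ x, vphi (-x) = vphi x
  convex : ConvexOn ℝ Set.univ vphi
  increasing : StrictMonoOn vphi (Set.Ioi 0)
  zero : vphi 0 = 0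
  tendsto_zero : Tendsto (fun x => vphi x / x) (𝓝[≠] 0) (𝓝 0)
  tendsto_top : Tendsto (fun x => vphi x / x) atTop atTop

/-- Assumption Q: an Orlicz N-function for which the limit of `vphi x / x ^ 2` at `0` exists and is
positive, possibly `+∞`. -/
def AssumptionQ (vphi : ℝ → ℝ) : Prop :=
  IsOrliczNFunction vphi ∧
    ((∃ c : ℝ, 0 < c ∧ Tendsto (fun x => vphi x / x ^ 2) (𝓝[≠] 0) (𝓝 c)) ∨
      Tendsto (fun x => vphi x / x ^ 2) (𝓝[≠] 0) atTop)

variable {Ω : Type*} [MeasurableSpace Ω]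

/-- `E exp (l ξ) ≤ exp (vphi (a l))` for all real `l` (with the left-hand side finite). -/
def ExpMomentBound (vphi : ℝ → ℝ) (P : Measure Ω) (ξ : Ω → ℝ) (a : ℝ) : Prop :=
  ∀ l : ℝ, Integrable (fun ω => Real.exp (l * ξ ω)) P ∧
    ∫ ω, Real.exp (l * ξ ω) ∂P ≤ Real.exp (vphi (a * l))

/-- `ξ ∈ Sub_vphi(Ω)`. -/
def IsSubPhi (vphi : ℝ → ℝ) (P : Measure Ω) (ξ : Ω → ℝ) : Prop :=
  Integrable ξ P ∧ ∫ ω, ξ ω ∂P = 0 ∧ ∃ r : ℝ, 0 ≤ r ∧ ExpMomentBound vphi P ξ r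

/-- The norm `τ_vphi` of `Sub_vphi(Ω)`. -/
def tau (vphi : ℝ → ℝ) (P : Measure Ω) (ξ : Ω → ℝ) : ℝ :=
  sInf {a : ℝ | 0 ≤ a ∧ ExpMomentBound vphi P ξ a}

/-- The process `X` on the real line belongs to `Sub_vphi(Ω)`. -/
def IsSubPhiProcess (vphi : ℝ → ℝ) (P : Measure Ω) (X : ℝ → Ω → ℝ) : Prop :=
  (∀ t, IsSubPhi vphi P (X t)) ∧ BddAbove (Set.range fun t => tau vphi P (X t))

/-- The process `X` is continuous in the norm `τ_vphi`. -/
def TauContinuous (vphi : ℝ → ℝ) (P : Measure Ω) (X : ℝ → Ω → ℝ) : Prop :=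
  ∀ t₀ : ℝ, Tendsto (fun t => tau vphi P (fun ω => X t ω - X t₀ ω)) (𝓝 t₀) (𝓝 0)

/-- The Fourier transform `y ↦ ∫ exp (-i y x) f x dx`. -/
def fourierHat (f : ℝ → ℂ) (y : ℝ) : ℂ :=
  ∫ x : ℝ, Complex.exp (-(Complex.I * y * x)) * f x

/-- `m₀` is `2π`-periodic, in `L₂([0, 2π])`, and `φ̂ y = m₀ (y / 2) φ̂ (y / 2)` almost everywhere. -/
structure IsScalingFilter (phi m₀ : ℝ → ℂ) : Prop where
  memLp : MemLp m₀ 2 (volume.restrict (Set.Icc 0 (2 * Real.pi)))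
  periodic : Function.Periodic m₀ (2 * Real.pi)
  scaling : ∀ᵐ y : ℝ, fourierHat phi y = m₀ (y / 2) * fourierHat phi (y / 2)

/-- `phi` is an f-wavelet. Integrability, which Assumption S implies, makes the integral
defining the Fourier transform meaningful at every point. -/
structure IsFWavelet (phi : ℝ → ℂ) : Prop where
  memLp : MemLp phi 2 volume
  integrable : Integrable phi volume
  hat_zero_ne : fourierHat phi 0 ≠ 0
  hat_continuousAt : ContinuousAt (fourierHat phi) 0
  sum_hat : ∀ᵐ y : ℝ, HasSum (fun k : ℤ => ‖fourierHat phi (y + 2 * Real.pi * k)‖ ^ 2) 1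
  exists_filter : ∃ m₀, IsScalingFilter phi m₀

/-- `psi` is the m-wavelet of `phi`: it is the inverse Fourier transform of
`conj (m₀ (y / 2 + π)) exp (-i y / 2) φ̂ (y / 2)`. That function is only known to be
square integrable, so the inversion is expressed by saying that it is the Fourier transform of the
function `psi`, which lies in `L₁ ∩ L₂` (Assumption S for `psi` gives integrability). -/
def IsMWavelet (phi psi : ℝ → ℂ) : Prop :=
  MemLp psi 2 volume ∧ Integrable psi volume ∧ ∃ m₀, IsScalingFilter phi m₀ ∧
    ∀ᵐ y : ℝ, fourierHat psi y =
      (starRingEnd ℂ) (m₀ (y / 2 + Real.pi)) * Complex.exp (-(Complex.I * (y / 2))) *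
        fourierHat phi (y / 2)

/-- Assumption S for `f` with majorant `Phi`. -/
def AssumptionS (f : ℝ → ℂ) (Phi : ℝ → ℝ) : Prop :=
  AntitoneOn Phi (Set.Ici 0) ∧ (∀ᵐ x : ℝ, ‖f x‖ ≤ Phi |x|) ∧
    Integrable (fun x : ℝ => Phi |x|) volume

/-- `f_{jk} x = 2 ^ (j / 2) f (2 ^ j x - k)`. -/
def dilate (f : ℝ → ℂ) (j k : ℤ) (x : ℝ) : ℂ :=
  (((2 : ℝ) ^ ((j : ℝ) / 2) : ℝ) : ℂ) * f ((2 : ℝ) ^ j * x - k)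

/-- The random variable `ξ` is the mean-square integral of the process `Y` over the real line:
the Bochner integral of `t ↦ Y t` as a map from the real line to the Hilbert space `L₂(Ω)`. -/
def IsMeanSquareIntegral (P : Measure Ω) (Y : ℝ → Ω → ℂ) (ξ : Ω → ℂ) : Prop :=
  ∃ F : ℝ → Lp ℂ 2 P, (∀ t, F t =ᵐ[P] Y t) ∧ Integrable F volume ∧
    ((∫ t : ℝ, F t : Lp ℂ 2 P) : Ω → ℂ) =ᵐ[P] ξ

/-- The random variable `ξ` is the mean-square integral `∫ X t conj (g t) dt`. -/
def IsCoefficient (P : Measure Ω) (X : ℝ → Ω → ℝ) (g : ℝ → ℂ) (ξ : Ω → ℂ) : Prop :=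
  IsMeanSquareIntegral P (fun t ω => (X t ω : ℂ) * (starRingEnd ℂ) (g t)) ξ

/-- The approximant
`∑_{|k| ≤ k₀'} ξ_{0k} φ_{0k} t + ∑_{j < n} ∑_{|k| ≤ k_j} η_{jk} ψ_{jk} t`. -/
def approximant (phi psi : ℝ → ℂ) (ξ : ℤ → Ω → ℂ) (η : ℕ → ℤ → Ω → ℂ)
    (n k₀' : ℕ) (κ : ℕ → ℕ) (t : ℝ) (ω : Ω) : ℂ :=
  ∑ k ∈ Finset.Icc (-(k₀' : ℤ)) k₀', ξ k ω * dilate phi 0 k t +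
    ∑ j ∈ Finset.range n, ∑ k ∈ Finset.Icc (-(κ j : ℤ)) (κ j), η j k ω * dilate psi j k t

end SubPhiWavelet

end

/-! The norm `tau` dominates the norm of L₂(Ω) (`ExpMomentBound.eLpNorm_le_tau`). Hence the process
is a bounded continuous curve Y from ℝ to L₂(Ω), its coefficients are Bochner integrals, and the
claim becomes deterministic: the wavelet expansion of a bounded continuous Banach-valued curve
converges at every point (`IsRefinable.tendsto_expansion`). Such a curve need not be square
integrable in time, so orthonormal expansions in L₂(ℝ) do not apply; absolutely summable series
replace them.

Continuity and the integrable monotone majorant make the integer translates of phi and psi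
absolutely summable, uniformly in the point. The numbers 2h_k = ∫ conj(phi(x - k)) phi(x/2) dx are
then absolutely summable, m₀ is the sum of its Fourier series, and the frequency relations become
two-scale equations valid at every point (`exists_isRefinable`).

Let P_n Y(t) = ∑ phi(2^n t - k) ∫ conj(phi(s - k)) Y(s/2^n) ds. Perfect reconstruction in the
two-channel filter bank (`perfect_reconstruction`, `filterBank_reconstruction`) shows that P_{n+1} -
P_n is the full sum of the psi-terms of level n, so the untruncated expansion telescopes to P_n
(`IsRefinable.projection_eq_sum`). Moreover P_n Y(t) tends to Y(t)
(`IsRefinable.tendsto_projection`), because conj(∫ phi) ∑ phi(x - k) = 1: P_n averages Y with total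
mass one near t. This partition of unity comes from the filter: h sums to 1/2 over each parity
class, so ∑ phi(x - k) is invariant under x ↦ 2x and therefore constant.

Truncating level j with an error proportional to 2^{-j} gives convergence in the product order
(`tendsto_truncated`). -/

namespace SubPhiWavelet
open ComplexConjugate

/-! ### Summable majorants for integer translates -/

/-- A uniform summable bound for the integer translates of `f`, that is, `f` lies in the Wiener
amalgam space of locally bounded, globally summable functions. -/
def HasWienerBound (f : ℝ → ℂ) (w : ℤ → ℝ) : Prop :=
  Summable w ∧ ∀ (x : ℝ) (k : ℤ), ‖f (Int.fract x - k)‖ ≤ w k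

namespace HasWienerBound

variable {f : ℝ → ℂ} {w : ℤ → ℝ}

theorem nonneg (hf : HasWienerBound f w) (k : ℤ) : 0 ≤ w k :=
  (norm_nonneg _).trans (hf.2 0 k)

theorem norm_le (hf : HasWienerBound f w) (x : ℝ) (k : ℤ) : ‖f (x - k)‖ ≤ w (k - ⌊x⌋) := by
  have h := hf.2 x (k - ⌊x⌋)
  have e : Int.fract x - ((k - ⌊x⌋ : ℤ) : ℝ) = x - k := by
    rw [Int.fract]; push_cast; ring
  rwa [e] at h

theorem summable_shift (hf : HasWienerBound f w) (x : ℝ) : Summable fun k : ℤ => w (k - ⌊x⌋) :=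
  (Equiv.subRight ⌊x⌋).summable_iff.2 hf.1

theorem summable_norm (hf : HasWienerBound f w) (x : ℝ) : Summable fun k : ℤ => ‖f (x - k)‖ :=
  .of_nonneg_of_le (fun _ => norm_nonneg _) (hf.norm_le x) (hf.summable_shift x)

theorem tsum_norm_le (hf : HasWienerBound f w) (x : ℝ) : ∑' k : ℤ, ‖f (x - k)‖ ≤ ∑' k, w k := by
  calc ∑' k : ℤ, ‖f (x - k)‖ ≤ ∑' k : ℤ, w (k - ⌊x⌋) :=
        (hf.summable_norm x).tsum_le_tsum (hf.norm_le x) (hf.summable_shift x)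
    _ = ∑' k, w k := (Equiv.subRight ⌊x⌋).tsum_eq w

theorem norm_le_tsum (hf : HasWienerBound f w) (x : ℝ) : ‖f x‖ ≤ ∑' k, w k := by
  have h := hf.norm_le x 0
  simp only [Int.cast_zero, sub_zero] at h
  exact h.trans (hf.1.le_tsum _ fun k _ => hf.nonneg k)

end HasWienerBound

/-- A violation at x persists on a neighbourhood by continuity. Moving away from the origin only
lowers the majorant, so an admissible point of the dense full-measure set on the outer side of x
gives a contradiction. -/
theorem AssumptionS.norm_le {f : ℝ → ℂ} {Phi : ℝ → ℝ} (hS : AssumptionS f Phi)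
    (hf : Continuous f) (x : ℝ) : ‖f x‖ ≤ Phi |x| := by
  obtain ⟨hanti, hae, -⟩ := hS
  by_contra! hlt
  have hd : Dense {y : ℝ | ‖f y‖ ≤ Phi |y|} := Measure.dense_of_ae hae
  have hU : {y : ℝ | Phi |x| < ‖f y‖} ∈ 𝓝 x :=
    (isOpen_lt continuous_const hf.norm).mem_nhds hlt
  obtain ⟨δ, hδ, hball⟩ := Metric.mem_nhds_iff.1 hU
  have key : ∃ y, y ∈ Metric.ball x δ ∧ ‖f y‖ ≤ Phi |y| ∧ |x| ≤ |y| := by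
    rcases le_total 0 x with hx | hx
    · obtain ⟨y, hy, hyS⟩ := hd.exists_mem_open isOpen_Ioo
        (show (Set.Ioo x (x + δ)).Nonempty from ⟨x + δ / 2, by constructor <;> linarith⟩)
      refine ⟨y, ?_, hy, ?_⟩
      · rw [Metric.mem_ball, Real.dist_eq, abs_of_pos] <;> linarith [hyS.1, hyS.2]
      · rw [abs_of_nonneg hx, abs_of_nonneg (hx.trans hyS.1.le)]; exact hyS.1.le
    · obtain ⟨y, hy, hyS⟩ := hd.exists_mem_open isOpen_Ioo
        (show (Set.Ioo (x - δ) x).Nonempty from ⟨x - δ / 2, by constructor <;> linarith⟩)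
      refine ⟨y, ?_, hy, ?_⟩
      · rw [Metric.mem_ball, Real.dist_eq, abs_of_neg] <;> linarith [hyS.1, hyS.2]
      · rw [abs_of_nonpos hx, abs_of_nonpos (hyS.2.le.trans hx)]; linarith [hyS.2.le]
  obtain ⟨y, hyb, hy, hxy⟩ := key
  have h1 : Phi |x| < ‖f y‖ := hball hyb
  have h2 : Phi |y| ≤ Phi |x| := hanti (abs_nonneg x) (abs_nonneg y) hxy
  linarith

/-- The integral test turns integrability of the monotone majorant into summability over the
integers. -/
theorem AssumptionS.exists_wienerBound {f : ℝ → ℂ} {Phi : ℝ → ℝ} (hS : AssumptionS f Phi)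
    (hf : Continuous f) : ∃ w, HasWienerBound f w := by
  have hle := hS.norm_le hf
  obtain ⟨hanti, -, hint⟩ := hS
  have hnn : ∀ x, 0 ≤ x → 0 ≤ Phi x := fun x hx => by
    simpa [abs_of_nonneg hx] using (norm_nonneg _).trans (hle x)
  have hsumN : Summable fun n : ℕ => Phi n := by
    refine AntitoneOn.summable_of_integrableOn_Ioi_zero hanti ?_ fun x hx => hnn x (le_of_lt hx)
    refine (hint.integrableOn (s := Set.Ioi 0)).congr_fun (fun x hx => ?_) measurableSet_Ioi
    simp [abs_of_pos (Set.mem_Ioi.1 hx)]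
  -- The fractional part lies in [0, 1), so its distance to k is at least |k| - 1; truncated
  -- subtraction covers k = 0.
  refine ⟨fun k => Phi ((k.natAbs - 1 : ℕ) : ℝ), ?_, fun x k => ?_⟩
  · have hpred : Summable fun n : ℕ => Phi ((n - 1 : ℕ) : ℝ) := by
      rw [← summable_nat_add_iff 1]; simpa using hsumN
    exact .of_nat_of_neg (by simpa using hpred) (by simpa using hpred)
  · refine (hle _).trans (hanti ?_ (Set.mem_Ici.2 (abs_nonneg _)) ?_)
    · exact Nat.cast_nonneg (α := ℝ) _
    · have h0 := Int.fract_nonneg x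
      have h1 := Int.fract_lt_one x
      have hk : |(k : ℝ)| = (k.natAbs : ℝ) := by rw [Nat.cast_natAbs]; simp
      have h3 : |(k : ℝ)| ≤ |Int.fract x - k| + |Int.fract x| := by
        have := abs_sub (Int.fract x) (Int.fract x - k)
        simp only [sub_sub_cancel] at this
        linarith
      rw [abs_of_nonneg h0] at h3
      rcases Nat.eq_zero_or_pos k.natAbs with h | h
      · simp [h]
      · rw [Nat.cast_sub h, ← hk]; push_cast; linarith

/-! ### Coefficients of a vector-valued curve -/

/-- The coefficient `∫ conj (f (s - k)) Y s ds`. -/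
noncomputable def shiftCoeff {E : Type*} [NormedAddCommGroup E] [NormedSpace ℂ E] (f : ℝ → ℂ)
    (Y : ℝ → E) (k : ℤ) : E := ∫ s : ℝ, conj (f (s - k)) • Y s

section Coeff

variable {E : Type*} [NormedAddCommGroup E] [NormedSpace ℂ E] {f phi : ℝ → ℂ} {Y : ℝ → E} {M : ℝ}

theorem integrable_conj_comp_smul (hf : Integrable f) (hY : Continuous Y) (hM : ∀ s, ‖Y s‖ ≤ M)
    (k : ℝ) : Integrable fun s : ℝ => conj (f (s - k)) • Y s := by
  have h1 : Integrable fun s : ℝ => conj (f (s - k)) :=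
    (LinearIsometryEquiv.integrable_comp_iff (RCLike.conjLIE (K := ℂ))).2 (hf.comp_sub_right k)
  exact h1.smul_of_top_left (memLp_top_of_bound hY.aestronglyMeasurable M (ae_of_all _ hM))

theorem norm_shiftCoeff_le (hf : Integrable f) (hM : ∀ s, ‖Y s‖ ≤ M) (k : ℤ) :
    ‖shiftCoeff f Y k‖ ≤ M * ∫ s, ‖f s‖ := by
  rw [← integral_sub_right_eq_self (fun s => ‖f s‖) (k : ℝ), ← integral_const_mul]
  refine norm_integral_le_of_norm_le ((hf.comp_sub_right (k : ℝ)).norm.const_mul M)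
    (ae_of_all _ fun s => ?_)
  rw [norm_smul, RCLike.norm_conj, mul_comm]
  gcongr
  exact hM s

/-- The coefficients of a function given by a refinement equation. -/
theorem hasSum_shiftCoeff [CompleteSpace E] {h : ℤ → ℂ} (hh : Summable fun l => ‖h l‖)
    (hphi : Integrable phi)
    (href : ∀ x, HasSum (fun l : ℤ => 2 * h l * phi (2 * x - l)) (f x))
    (hY : Continuous Y) (hM : ∀ s, ‖Y s‖ ≤ M) (k : ℤ) :
    HasSum (fun l : ℤ => conj (h l) • shiftCoeff phi (fun s => Y (s / 2)) (2 * k + l))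
      (shiftCoeff f Y k) := by
  have hY2 : Continuous fun s => Y (s / 2) := hY.comp (by fun_prop)
  have hM0 : 0 ≤ M := (norm_nonneg _).trans (hM 0)
  let G : ℤ → ℝ → E := fun l u => conj (phi (u - (2 * k + l : ℤ))) • Y (u / 2)
  have hG : ∀ l, Integrable (G l) := fun l =>
    integrable_conj_comp_smul hphi hY2 (fun s => hM _) _
  have hGint : ∀ l, ∫ u, G l u = shiftCoeff phi (fun s => Y (s / 2)) (2 * k + l) := fun l => rfl
  -- These are the terms of the conjugated refinement series at s - k, times Y s. The factor 2
  -- cancels the Jacobian of u = 2s.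
  let F : ℤ → ℝ → E := fun l s => (2 * conj (h l)) • G l (2 * s)
  have hF : ∀ l, Integrable (F l) := fun l =>
    ((hG l).comp_mul_left' two_ne_zero).smul _
  have hFint : ∀ l, ∫ s, F l s = conj (h l) • shiftCoeff phi (fun s => Y (s / 2)) (2 * k + l) := by
    intro l
    simp only [F]
    rw [integral_smul, Measure.integral_comp_mul_left (G l) 2, hGint]
    rw [abs_of_pos (by norm_num), ← Complex.coe_smul, smul_smul]
    congr 1
    push_cast
    ring
  have hFnorm : Summable fun l => ∫ s, ‖F l s‖ := by
    refine Summable.of_nonneg_of_le (fun l => integral_nonneg fun s => norm_nonneg _)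
      (fun l => ?_) (hh.mul_right (M * ∫ s, ‖phi s‖))
    have e1 : ∀ s, ‖F l s‖ = 2 * ‖h l‖ * ‖G l (2 * s)‖ := fun s => by
      simp only [F, norm_smul, norm_mul, RCLike.norm_conj]
      norm_num
    simp only [e1]
    rw [integral_const_mul, Measure.integral_comp_mul_left (fun u => ‖G l u‖) 2,
      abs_of_pos (by norm_num), smul_eq_mul]
    have e2 : ∫ u, ‖G l u‖ ≤ M * ∫ s, ‖phi s‖ := by
      rw [← integral_sub_right_eq_self (fun s => ‖phi s‖) ((2 * k + l : ℤ) : ℝ),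
        ← integral_const_mul]
      refine integral_mono (hG l).norm ((hphi.comp_sub_right _).norm.const_mul M) fun s => ?_
      simp only [G, norm_smul, RCLike.norm_conj]
      rw [mul_comm]
      gcongr
      exact hM _
    have : 2 * ‖h l‖ * (2⁻¹ * ∫ u, ‖G l u‖) = ‖h l‖ * ∫ u, ‖G l u‖ := by ring
    rw [this]
    gcongr
  have := hasSum_integral_of_summable_integral_norm hF hFnorm
  simp only [hFint] at this
  convert this using 1
  refine integral_congr_ae (ae_of_all _ fun s => ?_)
  have hs := ((href (s - k)).map (starRingEnd ℂ) Complex.continuous_conj)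
  have hs' := hs.smul_const (Y s)
  refine (hs'.tsum_eq.symm.trans ?_)
  congr 1
  ext l
  simp only [F, G, Function.comp, map_mul, smul_smul]
  rw [show 2 * (s - (k : ℝ)) - l = 2 * s - (2 * k + l : ℤ) by push_cast; ring,
    show 2 * s / 2 = s by ring, map_ofNat]

end Coeff


/-! ### Quadrature mirror filters and perfect reconstruction -/

/-- The high-pass filter associated with the low-pass filter `h`. -/
noncomputable def mirror (h : ℤ → ℂ) (l : ℤ) : ℂ := (-1) ^ (1 - l) * conj (h (1 - l))

theorem norm_mirror (h : ℤ → ℂ) (l : ℤ) : ‖mirror h l‖ = ‖h (1 - l)‖ := by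
  simp [mirror]

theorem summable_norm_mirror {h : ℤ → ℂ} (hh : Summable fun l => ‖h l‖) :
    Summable fun l => ‖mirror h l‖ := by
  simp only [norm_mirror]
  exact (Equiv.subLeft (1 : ℤ)).summable_iff.2 hh

/-- The orthogonality of the even translates of a low-pass filter. -/
def IsQMF (h : ℤ → ℂ) : Prop :=
  ∀ m : ℤ, HasSum (fun l => conj (h l) * h (2 * m + l)) (if m = 0 then 1 / 2 else 0)

theorem hasSum_of_parity {E : Type*} [AddCommMonoid E] [TopologicalSpace E] [ContinuousAdd E]
    {F : ℤ → E} {a b : ℤ} (hab : Odd (a - b)) {A B : E}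
    (hA : HasSum (fun k => F (a - 2 * k)) A) (hB : HasSum (fun k => F (b + 2 * k)) B) :
    HasSum F (A + B) := by
  have ia : Function.Injective fun k : ℤ => a - 2 * k := fun x y h => by
    simp only at h; omega
  have ib : Function.Injective fun k : ℤ => b + 2 * k := fun x y h => by
    simp only at h; omega
  obtain ⟨m, hm⟩ := hab
  have hc : IsCompl (Set.range fun k : ℤ => a - 2 * k) (Set.range fun k : ℤ => b + 2 * k) := by
    rw [isCompl_iff, Set.disjoint_iff, codisjoint_iff_le_sup]
    constructor
    · rintro x ⟨⟨k, rfl⟩, l, hl⟩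
      simp only at hl
      omega
    · rintro x -
      rcases Int.even_or_odd' (a - x) with ⟨k, hk | hk⟩
      · exact Or.inl ⟨k, by simp only; omega⟩
      · exact Or.inr ⟨m - k, by simp only; omega⟩
  exact (ia.hasSum_range_iff.2 hA).add_isCompl hc (ib.hasSum_range_iff.2 hB)

theorem summable_norm_mul_shift {h h' : ℤ → ℂ} (hh : Summable fun l => ‖h l‖)
    (hh' : Summable fun l => ‖h' l‖) (p p' : ℤ) :
    Summable fun k : ℤ => ‖h (p - 2 * k) * h' (p' - 2 * k)‖ := by
  have ip : Function.Injective fun k : ℤ => (p - 2 * k, p' - 2 * k) := fun x y hxy => by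
    simp only [Prod.mk.injEq] at hxy; omega
  have := (hh.mul_norm hh').comp_injective ip
  simpa only [Function.comp_def] using this

/-- The sign in the mirror channel depends only on the parity of p + p'. For odd parity the channels
cancel; for even parity they supply the two parity classes of one series in the filter's
orthogonality relation. -/
theorem perfect_reconstruction {h : ℤ → ℂ} (hh : Summable fun l => ‖h l‖) (hq : IsQMF h)
    (p p' : ℤ) :
    ∑' k : ℤ, conj (h (p - 2 * k)) * h (p' - 2 * k)
      + ∑' k : ℤ, conj (mirror h (p - 2 * k)) * mirror h (p' - 2 * k)
      = if p = p' then 1 / 2 else 0 := by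
  have hhc : Summable fun l => ‖conj (h l)‖ := by simpa using hh
  have sgn : ∀ k : ℤ, conj (mirror h (p - 2 * k)) * mirror h (p' - 2 * k)
      = (-1) ^ (p + p') * (h (1 - p + 2 * k) * conj (h (1 - p' + 2 * k))) := by
    intro k
    have e : ((-1 : ℂ)) ^ (1 - (p - 2 * k)) * (-1) ^ (1 - (p' - 2 * k)) = (-1) ^ (p + p') := by
      rw [← zpow_add₀ (by norm_num)]
      rcases Int.even_or_odd (p + p') with he | ho
      · rw [he.neg_one_zpow, Even.neg_one_zpow]
        have : 1 - (p - 2 * k) + (1 - (p' - 2 * k)) = 2 * (1 + 2 * k) - (p + p') := by ring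
        rw [this]
        exact (even_two_mul _).sub he
      · rw [ho.neg_one_zpow, Odd.neg_one_zpow]
        have : 1 - (p - 2 * k) + (1 - (p' - 2 * k)) = 2 * (1 + 2 * k) - (p + p') := by ring
        rw [this]
        exact (even_two_mul _).sub_odd ho
    rw [← e, mirror, mirror, map_mul, Complex.conj_conj, map_zpow₀, map_neg, map_one,
      show 1 - (p - 2 * k) = 1 - p + 2 * k by ring, show 1 - (p' - 2 * k) = 1 - p' + 2 * k by ring]
    ring
  simp only [sgn]
  rw [tsum_mul_left]
  rcases Int.even_or_odd' (p' - p) with ⟨m, hm | hm⟩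
  · have he : Even (p + p') := by
      rw [show p + p' = 2 * (p + m) by omega]; exact even_two_mul _
    rw [he.neg_one_zpow, one_mul]
    have s1 := (summable_norm_mul_shift hhc hh p p').of_norm.hasSum
    have s2 : Summable fun k : ℤ => conj (h (1 - p' + 2 * k)) * h (2 * m + (1 - p' + 2 * k)) := by
      have := (summable_norm_mul_shift hhc hh (1 - p') (1 - p)).of_norm
      refine ((Equiv.neg ℤ).summable_iff.2 this).congr fun k => ?_
      simp only [Function.comp, Equiv.neg_apply]
      rw [show 1 - p' - 2 * -k = 1 - p' + 2 * k by ring,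
        show 1 - p - 2 * -k = 2 * m + (1 - p' + 2 * k) by omega]
    have s1' : HasSum (fun k : ℤ => (fun l => conj (h l) * h (2 * m + l)) (p - 2 * k))
        (∑' k : ℤ, conj (h (p - 2 * k)) * h (p' - 2 * k)) := by
      simpa only [show ∀ k : ℤ, 2 * m + (p - 2 * k) = p' - 2 * k from fun k => by omega] using s1
    -- The mirror channel runs over l = 1 - p' + 2k, of parity opposite to p, so together the
    -- channels exhaust ℤ.
    have tot := hasSum_of_parity (F := fun l => conj (h l) * h (2 * m + l)) (b := 1 - p')
      ⟨p + m - 1, by omega⟩ s1' s2.hasSum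
    have e2 : ∀ k : ℤ, h (1 - p + 2 * k) * conj (h (1 - p' + 2 * k))
        = conj (h (1 - p' + 2 * k)) * h (2 * m + (1 - p' + 2 * k)) := fun k => by
      rw [mul_comm, show 2 * m + (1 - p' + 2 * k) = 1 - p + 2 * k by omega]
    simp only [e2]
    rw [tot.unique (hq m)]
    congr 1
    apply propext
    constructor <;> intro <;> omega
  · have ho : Odd (p + p') := ⟨p + m, by omega⟩
    rw [ho.neg_one_zpow, if_neg (by omega)]
    -- The reflection k ↦ p + m - k exchanges the two factors, so the channels differ only in sign.
    have : ∑' k : ℤ, h (1 - p + 2 * k) * conj (h (1 - p' + 2 * k))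
        = ∑' k : ℤ, conj (h (p - 2 * k)) * h (p' - 2 * k) := by
      rw [← (Equiv.subLeft (p + m)).tsum_eq]
      refine tsum_congr fun k => ?_
      simp only [Equiv.subLeft_apply]
      rw [show 1 - p + 2 * (p + m - k) = p' - 2 * k by omega,
        show 1 - p' + 2 * (p + m - k) = p - 2 * k by omega, mul_comm]
    rw [this]
    ring

/-! ### The two-channel filter bank on bounded sequences -/

section FilterBank

variable {E : Type*} [NormedAddCommGroup E] [NormedSpace ℂ E] [CompleteSpace E]
  {h : ℤ → ℂ} {a : ℤ → ℂ} {ζ : ℤ → E} {M : ℝ}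

/-- Absolute summability of the triple series licenses every interchange below. An injective change
of indices embeds it in the product of the series of h, h and a. -/
theorem summable_filterBank (hh : Summable fun l => ‖h l‖) (ha : Summable fun l => ‖a l‖)
    (hζ : ∀ k, ‖ζ k‖ ≤ M) :
    Summable fun q : ℤ × ℤ × ℤ =>
      (2 * conj (h (q.2.1 - 2 * q.1)) * h (q.2.2 - 2 * q.1) * a q.2.2) • ζ q.2.1 := by
  have s3 : Summable fun q : ℤ × ℤ × ℤ => ‖h q.1‖ * (‖h q.2.1‖ * ‖a q.2.2‖) :=
    hh.mul_of_nonneg (hh.mul_of_nonneg ha (fun _ => norm_nonneg _) fun _ => norm_nonneg _)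
      (fun _ => norm_nonneg _) fun _ => by positivity
  have inj : Function.Injective fun q : ℤ × ℤ × ℤ =>
      (q.2.1 - 2 * q.1, q.2.2 - 2 * q.1, q.2.2) := by
    rintro ⟨k, p, p'⟩ ⟨l, r, r'⟩ hq
    simp only [Prod.mk.injEq] at hq ⊢
    omega
  refine .of_norm_bounded ((s3.comp_injective inj).mul_left (2 * M)) fun q => ?_
  simp only [Function.comp, norm_smul, norm_mul, RCLike.norm_conj, Complex.norm_ofNat]
  calc _ ≤ 2 * ‖h (q.2.1 - 2 * q.1)‖ * ‖h (q.2.2 - 2 * q.1)‖ * ‖a q.2.2‖ * M := by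
        gcongr; exact hζ _
    _ = _ := by ring

/-- One channel of the filter bank, as a double series. -/
theorem tsum_channel (hh : Summable fun l => ‖h l‖) (ha : Summable fun l => ‖a l‖)
    (hζ : ∀ k, ‖ζ k‖ ≤ M) :
    ∑' k : ℤ, (∑' l : ℤ, 2 * h l * a (2 * k + l)) • ∑' l : ℤ, conj (h l) • ζ (2 * k + l)
      = ∑' q : ℤ × ℤ, (2 * (∑' k : ℤ, conj (h (q.1 - 2 * k)) * h (q.2 - 2 * k)) * a q.2) • ζ q.1
    := by
  have hs := summable_filterBank hh ha hζ
  have hfac : ∀ k : ℤ,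
      (∑' l : ℤ, 2 * h l * a (2 * k + l)) • ∑' l : ℤ, conj (h l) • ζ (2 * k + l)
        = ∑' q : ℤ × ℤ, (2 * conj (h (q.1 - 2 * k)) * h (q.2 - 2 * k) * a q.2) • ζ q.1 := by
    intro k
    have e1 : ∑' l : ℤ, 2 * h l * a (2 * k + l) = ∑' p : ℤ, 2 * h (p - 2 * k) * a p := by
      rw [← (Equiv.addLeft (2 * k)).tsum_eq fun p => 2 * h (p - 2 * k) * a p]
      refine tsum_congr fun l => ?_
      simp
    have e2 : ∑' l : ℤ, conj (h l) • ζ (2 * k + l) = ∑' p : ℤ, conj (h (p - 2 * k)) • ζ p := by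
      rw [← (Equiv.addLeft (2 * k)).tsum_eq fun p => conj (h (p - 2 * k)) • ζ p]
      refine tsum_congr fun l => ?_
      simp
    have hsk : Summable fun q : ℤ × ℤ =>
        (2 * conj (h (q.1 - 2 * k)) * h (q.2 - 2 * k) * a q.2) • ζ q.1 := hs.prod_factor k
    have hs2 : Summable fun p : ℤ => conj (h (p - 2 * k)) • ζ p := by
      refine .of_norm_bounded (((Equiv.subRight (2 * k)).summable_iff.2 hh).mul_right M)
        fun p => ?_
      rw [norm_smul, RCLike.norm_conj]
      simp only [Function.comp, Equiv.subRight_apply]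
      gcongr; exact hζ _
    have hsk' := (Equiv.prodComm ℤ ℤ).summable_iff.2 hsk
    rw [← (Equiv.prodComm ℤ ℤ).tsum_eq, e1, e2]
    have := hsk'.tsum_prod
    simp only [Function.comp, Equiv.prodComm_apply, Prod.swap] at this ⊢
    rw [this]
    have s1 : Summable fun p : ℤ => 2 * h (p - 2 * k) * a p := by
      have hb : ∀ p, ‖a p‖ ≤ ∑' l, ‖a l‖ := fun p => ha.le_tsum p fun _ _ => norm_nonneg _
      refine .of_norm_bounded (((Equiv.subRight (2 * k)).summable_iff.2 hh).mul_left
        (2 * ∑' l, ‖a l‖)) fun p => ?_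
      simp only [Function.comp, Equiv.subRight_apply, norm_mul, Complex.norm_ofNat]
      calc _ ≤ 2 * ‖h (p - 2 * k)‖ * ∑' l, ‖a l‖ := by gcongr; exact hb p
        _ = _ := by ring
    rw [← s1.tsum_smul_const]
    refine tsum_congr fun p' => ?_
    rw [← hs2.tsum_const_smul]
    refine tsum_congr fun p => ?_
    rw [smul_smul]
    congr 1
    ring
  simp only [hfac]
  rw [Summable.tsum_comm (f := fun (k : ℤ) (q : ℤ × ℤ) =>
    (2 * conj (h (q.1 - 2 * k)) * h (q.2 - 2 * k) * a q.2) • ζ q.1) hs |>.symm]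
  refine tsum_congr fun q => ?_
  have hhc : Summable fun l => ‖conj (h l)‖ := by simpa using hh
  have sk := (summable_norm_mul_shift hhc hh q.1 q.2).of_norm
  rw [← tsum_mul_left, ← tsum_mul_right, ← ((sk.mul_left 2).mul_right (a q.2)).tsum_smul_const]
  simp only [mul_assoc]

/-- Synthesis after analysis in the two-channel filter bank of `h` is the identity. -/
theorem filterBank_reconstruction (hh : Summable fun l => ‖h l‖) (hq : IsQMF h)
    (ha : Summable fun l => ‖a l‖) (hζ : ∀ k, ‖ζ k‖ ≤ M) :
    ∑' k : ℤ, (∑' l : ℤ, 2 * h l * a (2 * k + l)) • ∑' l : ℤ, conj (h l) • ζ (2 * k + l)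
      + ∑' k : ℤ, (∑' l : ℤ, 2 * mirror h l * a (2 * k + l)) •
          ∑' l : ℤ, conj (mirror h l) • ζ (2 * k + l)
      = ∑' p : ℤ, a p • ζ p := by
  have hg := summable_norm_mirror hh
  have hs : ∀ {h : ℤ → ℂ} (_ : Summable fun l => ‖h l‖), Summable fun q : ℤ × ℤ =>
      (2 * (∑' k : ℤ, conj (h (q.1 - 2 * k)) * h (q.2 - 2 * k)) * a q.2) • ζ q.1 := by
    intro h hh
    refine ((Equiv.prodComm (ℤ × ℤ) ℤ).summable_iff.2 (summable_filterBank hh ha hζ)).prod.congr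
      fun q => ?_
    have hhc : Summable fun l => ‖conj (h l)‖ := by simpa using hh
    have sk := (summable_norm_mul_shift hhc hh q.1 q.2).of_norm
    rw [← tsum_mul_left, ← tsum_mul_right, ← ((sk.mul_left 2).mul_right (a q.2)).tsum_smul_const]
    simp [mul_assoc]
  rw [tsum_channel hh ha hζ, tsum_channel hg ha hζ, ← (hs hh).tsum_add (hs hg)]
  have e : ∀ q : ℤ × ℤ,
      (2 * (∑' k : ℤ, conj (h (q.1 - 2 * k)) * h (q.2 - 2 * k)) * a q.2) • ζ q.1
        + (2 * (∑' k : ℤ, conj (mirror h (q.1 - 2 * k)) * mirror h (q.2 - 2 * k)) * a q.2) • ζ q.1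
      = if q.2 = q.1 then a q.1 • ζ q.1 else 0 := by
    intro q
    rw [← add_smul, ← add_mul, ← mul_add, perfect_reconstruction hh hq]
    split_ifs with h1 h2 h2
    · rw [h1]; norm_num
    · exact absurd h1.symm h2
    · exact absurd h2.symm h1
    · simp
  have hsum : Summable fun q : ℤ × ℤ => if q.2 = q.1 then a q.1 • ζ q.1 else 0 :=
    ((hs hh).add (hs hg)).congr fun q => e q
  rw [tsum_congr e, hsum.tsum_prod]
  exact tsum_congr fun p => tsum_ite_eq p fun _ => a p • ζ p

end FilterBank


/-- Any finite sum of the integrals is one integral, whose integrand is at most the uniform bound on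
∑ |f(x - k)| times the norm of Y. -/
theorem HasWienerBound.summable_integral_norm {E : Type*} [NormedAddCommGroup E]
    [NormedSpace ℂ E] {f : ℝ → ℂ} {w : ℤ → ℝ} (hw : HasWienerBound f w) (hf : Continuous f)
    {Y : ℝ → E} (hY : Integrable Y) :
    (∀ k : ℤ, Integrable fun x : ℝ => conj (f (x - k)) • Y x) ∧
      Summable fun k : ℤ => ∫ x : ℝ, ‖conj (f (x - k)) • Y x‖ := by
  have hint : ∀ k : ℤ, Integrable fun x : ℝ => conj (f (x - k)) • Y x := fun k =>
    hY.bdd_smul (∑' k, w k) (by fun_prop) (ae_of_all _ fun x => by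
      rw [RCLike.norm_conj]; exact hw.norm_le_tsum _)
  refine ⟨hint, summable_of_sum_le (c := ∫ x, (∑' k, w k) * ‖Y x‖)
    (fun k => integral_nonneg fun x => norm_nonneg _) fun u => ?_⟩
  rw [← integral_finsetSum _ fun k _ => (hint k).norm]
  refine integral_mono (integrable_finsetSum _ fun k _ => (hint k).norm) (hY.norm.const_mul _)
    fun x => ?_
  simp only [norm_smul, RCLike.norm_conj, ← Finset.sum_mul]
  gcongr
  exact ((hw.summable_norm x).sum_le_tsum u fun _ _ => norm_nonneg _).trans (hw.tsum_norm_le x)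

/-! ### Sums of the filter over parity classes -/

section QMF

variable {h : ℤ → ℂ}

/-- The two class sums satisfy e₀ + e₁ = 1 and |e₀|² + |e₁|² = 1/2, which forces both to equal 1/2.
-/
theorem hasSum_coset (hh : Summable fun l => ‖h l‖) (hq : IsQMF h) (h1 : HasSum h 1) (p : ℤ) :
    HasSum (fun k : ℤ => h (p - 2 * k)) (1 / 2) := by
  have hs : ∀ p : ℤ, Summable fun k : ℤ => h (p - 2 * k) := fun p =>
    hh.of_norm.comp_injective fun x y (hxy : p - 2 * x = p - 2 * y) => by omega
  set e : ℤ → ℂ := fun p => ∑' k : ℤ, h (p - 2 * k) with he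
  have hes : ∀ p, HasSum (fun k : ℤ => h (p - 2 * k)) (e p) := fun p => (hs p).hasSum
  have hes' : ∀ p, HasSum (fun k : ℤ => h (p + 2 * k)) (e p) := fun p => by
    have := (Equiv.neg ℤ).hasSum_iff.2 (hes p)
    simpa [Function.comp_def] using this
  have hper : ∀ p m, e (p - 2 * m) = e p := fun p m => by
    refine (((Equiv.addLeft m).hasSum_iff.2 (hes p)).unique ?_).symm
    convert hes (p - 2 * m) using 2 with k
    simp only [Function.comp, Equiv.coe_addLeft]
    congr 1; ring
  have hper' : ∀ p m, e (p + 2 * m) = e p := fun p m => by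
    have := hper p (-m)
    rwa [show p - 2 * -m = p + 2 * m by ring] at this
  have hsum : e 0 + e 1 = 1 :=
    (hasSum_of_parity (F := h) (a := 0) (b := 1) (by decide) (hes 0) (hes' 1)).unique h1
  have hinj : Function.Injective fun q : ℤ × ℤ => (q.2, 2 * q.1 + q.2) := by
    rintro ⟨a, b⟩ ⟨c, d⟩ hq
    simp only [Prod.mk.injEq] at hq ⊢
    omega
  have hhc : Summable fun l => ‖conj (h l)‖ := by simpa using hh
  have hdouble : Summable (Function.uncurry fun m l : ℤ => conj (h l) * h (2 * m + l)) := by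
    have := (hhc.mul_norm hh).comp_injective hinj
    exact Summable.of_norm (by simpa only [Function.comp_def, Function.uncurry] using this)
  -- Obtained by summing the orthogonality relations over all m and grouping l by parity.
  have hnorm : conj (e 0) * e 0 + conj (e 1) * e 1 = 1 / 2 := by
    have a1 : ∑' m : ℤ, ∑' l : ℤ, conj (h l) * h (2 * m + l) = 1 / 2 := by
      rw [tsum_congr fun m => (hq m).tsum_eq]
      exact tsum_ite_eq 0 fun _ => (1 / 2 : ℂ)
    have a2 : HasSum (fun l : ℤ => conj (h l) * e l)
        (conj (e 0) * e 0 + conj (e 1) * e 1) := by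
      refine hasSum_of_parity (F := fun l => conj (h l) * e l) (a := 0) (b := 1) (by decide) ?_ ?_
      · simp only [hper]
        exact ((hes 0).map (starRingEnd ℂ) Complex.continuous_conj).mul_right _
      · simp only [hper']
        exact ((hes' 1).map (starRingEnd ℂ) Complex.continuous_conj).mul_right _
    rw [← a1, ← hdouble.tsum_comm, ← a2.tsum_eq]
    refine tsum_congr fun l => ?_
    rw [tsum_mul_left, ← (hes' l).tsum_eq]
    congr 1
    exact tsum_congr fun m => by rw [add_comm]
  have h0 : e 0 = 1 / 2 := by
    have h2 : e 1 = 1 - e 0 := by rw [← hsum]; ring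
    rw [h2] at hnorm
    have : Complex.normSq (e 0 - 1 / 2) = 0 := by
      -- With e₁ = 1 - e₀, the quadratic identity is twice the vanishing of |e₀ - 1/2|².
      have hn : conj (e 0 - 1 / 2) * (e 0 - 1 / 2) = 0 := by
        simp only [map_sub, map_one, map_div₀, map_ofNat] at hnorm ⊢
        linear_combination hnorm / 2
      rw [← Complex.normSq_eq_conj_mul_self] at hn
      exact_mod_cast hn
    rw [Complex.normSq_eq_zero] at this
    exact sub_eq_zero.1 this
  have h1' : e 1 = 1 / 2 := by rw [h0] at hsum; linear_combination hsum
  have : e p = 1 / 2 := by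
    rcases Int.even_or_odd' p with ⟨m, rfl | rfl⟩
    · have := hper' 0 m; rw [zero_add] at this; rw [this, h0]
    · rw [add_comm, hper', h1']
  rw [← this]
  exact hes p

end QMF

/-! ### Refinable functions: partition of unity and convergence of projections -/

/-- A continuous, integrable, orthonormal refinable function, well localised, with nonzero mean. -/
structure IsRefinable (phi : ℝ → ℂ) (w : ℤ → ℝ) (h : ℤ → ℂ) : Prop where
  continuous : Continuous phi
  integrable : Integrable phi
  bound : HasWienerBound phi w
  summable : Summable fun l => ‖h l‖
  refine_eq : ∀ x, HasSum (fun l : ℤ => 2 * h l * phi (2 * x - l)) (phi x)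
  coeff : ∀ p, shiftCoeff phi (fun s => phi (s / 2)) p = 2 * h p
  orthonormal : ∀ m, shiftCoeff phi phi m = if m = 0 then 1 else 0
  integral_ne : (∫ x, phi x) ≠ 0

namespace IsRefinable

variable {phi : ℝ → ℂ} {w : ℤ → ℝ} {h : ℤ → ℂ}

/-- The orthonormality relations, with one factor expanded by the refinement equation. -/
theorem isQMF (hR : IsRefinable phi w h) : IsQMF h := fun m => by
  have := hasSum_shiftCoeff hR.summable hR.integrable hR.refine_eq hR.continuous
    hR.bound.norm_le_tsum m
  simp only [hR.coeff, hR.orthonormal, smul_eq_mul] at this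
  have := this.mul_left (1 / 2)
  have e : (1 / 2 * if m = 0 then (1 : ℂ) else 0) = if m = 0 then 1 / 2 else 0 := by
    split_ifs <;> simp
  simpa only [e, show ∀ l, 1 / 2 * (conj (h l) * (2 * h (2 * m + l))) = conj (h l) * h (2 * m + l)
    from fun l => by ring] using this

/-- Apply the coefficient refinement to the constant curve 1 and cancel the nonzero mean of phi. -/
theorem hasSum_filter (hR : IsRefinable phi w h) : HasSum h 1 := by
  have hc : ∀ k, shiftCoeff phi (fun _ => (1 : ℂ)) k = conj (∫ x, phi x) := fun k => by
    simp only [shiftCoeff, smul_eq_mul, mul_one]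
    rw [integral_sub_right_eq_self (fun s => conj (phi s)) (k : ℝ), integral_conj]
  have := hasSum_shiftCoeff hR.summable hR.integrable hR.refine_eq
    (continuous_const (y := (1 : ℂ))) (M := 1) (fun _ => by simp) 0
  simp only [hc, smul_eq_mul] at this
  have hne : conj (∫ x, phi x) ≠ 0 := (map_ne_zero _).2 hR.integral_ne
  have h2 := (this.div_const (conj (∫ x, phi x))).map (starRingEnd ℂ) Complex.continuous_conj
  simpa [Function.comp_def, hne, hR.integral_ne] using h2

theorem summable_shift (hR : IsRefinable phi w h) (x : ℝ) : Summable fun k : ℤ => phi (x - k) :=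
  (hR.bound.summable_norm x).of_norm

/-- After refining every translate and exchanging sums, phi(2x - p) carries the weight 2 ∑_k h(p -
2k), which is 1 by `hasSum_coset`. -/
theorem tsum_shift_two_mul (hR : IsRefinable phi w h) (x : ℝ) :
    ∑' k : ℤ, phi (x - k) = ∑' k : ℤ, phi (2 * x - k) := by
  have hinj : Function.Injective fun q : ℤ × ℤ => (q.2 - 2 * q.1, q.2) := by
    rintro ⟨a, b⟩ ⟨c, d⟩ hq
    simp only [Prod.mk.injEq] at hq ⊢
    omega
  have hdouble : Summable (Function.uncurry fun k p : ℤ => h (p - 2 * k) * phi (2 * x - p)) := by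
    have := (hR.summable.mul_norm (hR.bound.summable_norm (2 * x))).comp_injective hinj
    exact Summable.of_norm (by simpa only [Function.comp_def, Function.uncurry] using this)
  have e1 : ∀ k : ℤ, phi (x - k) = 2 * ∑' p : ℤ, h (p - 2 * k) * phi (2 * x - p) := fun k => by
    rw [← (hR.refine_eq (x - k)).tsum_eq, ← (Equiv.subRight (2 * k)).tsum_eq, ← tsum_mul_left]
    refine tsum_congr fun p => ?_
    simp only [Equiv.subRight_apply]
    rw [show 2 * (x - (k : ℝ)) - ((p - 2 * k : ℤ) : ℝ) = 2 * x - p by push_cast; ring]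
    ring
  rw [tsum_congr e1, tsum_mul_left, ← hdouble.tsum_comm, ← tsum_mul_left]
  refine tsum_congr fun p => ?_
  rw [tsum_mul_right, (hasSum_coset hR.summable hR.isQMF hR.hasSum_filter p).tsum_eq]
  ring

/-- The periodization takes the same value at x and at every x/2^n, and it is continuous at 0. -/
theorem tsum_shift (hR : IsRefinable phi w h) (x : ℝ) :
    ∑' k : ℤ, phi (x - k) = ∑' k : ℤ, phi (0 - k) := by
  have hpow : ∀ n : ℕ, ∑' k : ℤ, phi (x / 2 ^ n - k) = ∑' k : ℤ, phi (x - k) := by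
    intro n
    induction n with
    | zero => simp
    | succ n ih =>
      rw [hR.tsum_shift_two_mul, ← ih]
      congr 1; ext k; congr 2
      rw [pow_succ]; field_simp
  have hx : Tendsto (fun n : ℕ => x / 2 ^ n) atTop (𝓝 0) :=
    tendsto_const_nhds.div_atTop (tendsto_pow_atTop_atTop_of_one_lt one_lt_two)
  have hlim : Tendsto (fun n : ℕ => ∑' k : ℤ, phi (x / 2 ^ n - k)) atTop
      (𝓝 (∑' k : ℤ, phi (0 - k))) := by
    -- Near 0 the floor is 0 or -1, according to sign; the two terms of the bound cover these cases.
    refine tendsto_tsum_of_dominated_convergence (bound := fun k => w k + w (k + 1))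
      (hR.bound.1.add ((Equiv.addRight (1 : ℤ)).summable_iff.2 hR.bound.1)) (fun k => ?_) ?_
    · exact (hR.continuous.tendsto _).comp (hx.sub_const _)
    · filter_upwards [hx.eventually (Ioo_mem_nhds neg_one_lt_zero one_pos)] with n hn k
      have hb := hR.bound.norm_le (x / 2 ^ n) k
      have n0 := hR.bound.nonneg k
      have n1 := hR.bound.nonneg (k + 1)
      rcases le_or_gt 0 (x / 2 ^ n) with h0 | h0
      · rw [Int.floor_eq_zero_iff.2 ⟨h0, hn.2⟩, sub_zero] at hb
        linarith
      · have : ⌊x / 2 ^ n⌋ = -1 := by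
          rw [Int.floor_eq_iff]; push_cast; constructor <;> linarith [hn.1]
        rw [this, sub_neg_eq_add] at hb
        linarith
  simp only [hpow] at hlim
  exact tendsto_nhds_unique tendsto_const_nhds hlim

/-- Summing the orthonormality relations over m puts the constant periodization under the integral
of phi. This fixes its value. -/
theorem conj_integral_mul_tsum (hR : IsRefinable phi w h) (x : ℝ) :
    conj (∫ x, phi x) * ∑' k : ℤ, phi (x - k) = 1 := by
  obtain ⟨hi, hs⟩ := hR.bound.summable_integral_norm hR.continuous hR.integrable
  have h1 := hasSum_integral_of_summable_integral_norm hi hs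
  have h2 : HasSum (fun m : ℤ => if m = 0 then (1 : ℂ) else 0) 1 := hasSum_ite_eq 0 1
  have h3 := h1.unique (by simpa only [← hR.orthonormal, shiftCoeff] using h2)
  have h4 : ∀ y, ∑' k : ℤ, conj (phi (y - k)) • phi y = conj (∑' k : ℤ, phi (x - k)) * phi y := by
    intro y
    simp only [smul_eq_mul]
    rw [tsum_mul_right, hR.tsum_shift x, ← hR.tsum_shift y, Complex.conj_tsum]
  simp only [h4] at h3
  rw [integral_const_mul] at h3
  have := congrArg conj h3
  simpa [mul_comm] using this

/-- Approximation of a bounded continuous function by its projections to finer and finer scales. -/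
theorem tendsto_projection (hR : IsRefinable phi w h) {E : Type*} [NormedAddCommGroup E]
    [NormedSpace ℂ E] [CompleteSpace E]
    {X : ℝ → E} {M : ℝ} (hX : Continuous X) (hM : ∀ s, ‖X s‖ ≤ M) (t : ℝ) :
    Tendsto (fun n : ℕ => ∑' k : ℤ, phi (2 ^ n * t - k) •
      shiftCoeff phi (fun s => X (s / 2 ^ n)) k) atTop (𝓝 (X t)) := by
  set c := conj (∫ x, phi x) with hc
  -- Recentring k at the floor of 2^n t leaves phi at a point of [0, 1) - k. The majorant w k then
  -- does not depend on n.
  let θ : ℕ → ℝ := fun n => Int.fract (2 ^ n * t)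
  let J : ℕ → ℤ → E := fun n k => ∫ v, conj (phi v) • X (t + (v + k - θ n) / 2 ^ n)
  have hθ : ∀ (n : ℕ) (z : ℝ), (z + ⌊2 ^ n * t⌋) / 2 ^ n = t + (z - θ n) / 2 ^ n := fun n z => by
    simp only [θ, Int.fract]
    field_simp
    ring
  have hJ : ∀ n k, shiftCoeff phi (fun s => X (s / 2 ^ n)) (k + ⌊2 ^ n * t⌋) = J n k := by
    intro n k
    simp only [shiftCoeff, J]
    rw [← integral_add_right_eq_self _ ((k + ⌊2 ^ n * t⌋ : ℤ) : ℝ)]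
    refine integral_congr_ae (ae_of_all _ fun v => ?_)
    simp only [add_sub_cancel_right]
    congr 2
    rw [← hθ]; push_cast; ring
  have hsum : ∀ n, ∑' k : ℤ, phi (2 ^ n * t - k) • shiftCoeff phi (fun s => X (s / 2 ^ n)) k
      = ∑' k : ℤ, phi (θ n - k) • J n k := by
    intro n
    rw [← (Equiv.addRight ⌊2 ^ n * t⌋).tsum_eq]
    refine tsum_congr fun k => ?_
    simp only [Equiv.coe_addRight]
    rw [hJ]
    congr 2
    simp only [θ, Int.fract]; push_cast; ring
  have hJb : ∀ n k, ‖J n k‖ ≤ M * ∫ s, ‖phi s‖ := fun n k => by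
    rw [← hJ]; exact norm_shiftCoeff_le hR.integrable (fun s => hM _) _
  have hXt : ∀ n, X t = ∑' k : ℤ, phi (θ n - k) • c • X t := fun n => by
    rw [(hR.summable_shift (θ n)).tsum_smul_const, smul_smul, mul_comm,
      hR.conj_integral_mul_tsum, one_smul]
  have hdiff : ∀ n, ∑' k : ℤ, phi (2 ^ n * t - k) • shiftCoeff phi (fun s => X (s / 2 ^ n)) k
      - X t = ∑' k : ℤ, phi (θ n - k) • (J n k - c • X t) := by
    intro n
    have s1 : Summable fun k : ℤ => phi (θ n - k) • J n k := by
      refine .of_norm_bounded ((hR.bound.summable_norm (θ n)).mul_right (M * ∫ s, ‖phi s‖))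
        fun k => ?_
      rw [norm_smul]; gcongr; exact hJb n k
    rw [hsum, hXt n, ← s1.tsum_sub ((hR.summable_shift (θ n)).smul_const _)]
    simp only [smul_sub, ← hXt n]
  rw [tendsto_iff_norm_sub_tendsto_zero]
  simp only [hdiff]
  rw [← tendsto_zero_iff_norm_tendsto_zero, ← tsum_zero (α := E) (β := ℤ)]
  have hwb : ∀ n (k : ℤ), ‖phi (θ n - k)‖ ≤ w k := fun n k => hR.bound.2 _ k
  refine tendsto_tsum_of_dominated_convergence
    (bound := fun k => w k * (M * (∫ s, ‖phi s‖) + ‖c • X t‖)) (hR.bound.1.mul_right _)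
    (fun k => ?_) (Eventually.of_forall fun n k => ?_)
  · have hJlim : Tendsto (fun n => J n k) atTop (𝓝 (c • X t)) := by
      have e : c • X t = ∫ v, conj (phi v) • X t := by
        rw [integral_smul_const, integral_conj]
      rw [e]
      refine tendsto_integral_of_dominated_convergence (fun v => ‖phi v‖ * M) (fun n => ?_)
        (hR.integrable.norm.mul_const M) (fun n => ae_of_all _ fun v => ?_)
        (ae_of_all _ fun v => ?_)
      · have := hR.continuous
        exact Continuous.aestronglyMeasurable (by fun_prop)
      · rw [norm_smul, RCLike.norm_conj]; gcongr; exact hM _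
      · refine tendsto_const_nhds.smul ((hX.tendsto t).comp ?_)
        -- For fixed v and k the numerator stays bounded, since θ n lies in [0, 1).
        have : Tendsto (fun n : ℕ => (v + k - θ n) / 2 ^ n) atTop (𝓝 0) := by
          refine squeeze_zero_norm (a := fun n : ℕ => (|v + k| + 1) / 2 ^ n) (fun n => ?_)
            (tendsto_const_nhds.div_atTop (tendsto_pow_atTop_atTop_of_one_lt one_lt_two))
          rw [norm_div, Real.norm_eq_abs, norm_pow, Real.norm_ofNat]
          gcongr
          refine (abs_sub _ _).trans ?_
          gcongr
          rw [abs_of_nonneg (Int.fract_nonneg _)]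
          exact (Int.fract_lt_one _).le
        simpa using this.const_add t
    have hd : Tendsto (fun n => w k * ‖J n k - c • X t‖) atTop (𝓝 0) := by
      simpa using (tendsto_iff_norm_sub_tendsto_zero.1 hJlim).const_mul (w k)
    refine squeeze_zero_norm (fun n => ?_) hd
    rw [norm_smul]; gcongr; exact hwb n k
  · rw [norm_smul]
    have := hR.bound.nonneg k
    gcongr
    · exact hwb n k
    · exact (norm_sub_le _ _).trans (by linarith [hJb n k])

end IsRefinable

/-! ### Fourier analysis: periodization, correlations and Fourier series -/

open scoped FourierTransform ENNReal

theorem ae_forall_add_int {P : ℝ → Prop} (h : ∀ᵐ x, P x) : ∀ᵐ x : ℝ, ∀ k : ℤ, P (x + k) :=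
  ae_all_iff.2 fun k => (measurePreserving_add_right volume (k : ℝ)).quasiMeasurePreserving.ae h

theorem ae_of_ae_restrict_Ioc {P : ℝ → Prop} (hP : ∀ x (k : ℤ), P (x + k) → P x)
    (h : ∀ᵐ x ∂volume.restrict (Set.Ioc (0 : ℝ) 1), P x) : ∀ᵐ x, P x := by
  rw [ae_restrict_iff' measurableSet_Ioc] at h
  filter_upwards [ae_forall_add_int h] with x hx
  refine hP x (1 - ⌈x⌉) (hx _ ?_)
  push_cast
  constructor <;> linarith [Int.ceil_lt_add_one x, Int.le_ceil x]

theorem restrict_Ioc_int_map (k : ℤ) :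
    MeasurePreserving (fun x : ℝ => x + k) (volume.restrict (Set.Ioc (0 : ℝ) 1))
      (volume.restrict (Set.Ioc (k : ℝ) (k + 1))) := by
  have := (measurePreserving_add_right volume (k : ℝ)).restrict_preimage
    (measurableSet_Ioc (a := (k : ℝ)) (b := k + 1))
  convert this using 2
  simp

theorem lintegral_eq_tsum_Ioc (f : ℝ → ℝ≥0∞) :
    ∫⁻ x, f x = ∑' k : ℤ, ∫⁻ x in Set.Ioc (0 : ℝ) 1, f (x + k) := by
  rw [← setLIntegral_univ, ← iUnion_Ioc_intCast ℝ,
    lintegral_iUnion (fun _ => measurableSet_Ioc) (Set.pairwise_disjoint_Ioc_intCast ℝ)]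
  refine tsum_congr fun k => ?_
  exact ((restrict_Ioc_int_map k).lintegral_comp_emb (measurableEmbedding_addRight (k : ℝ)) f).symm

theorem integral_eq_tsum_Ioc {f : ℝ → ℂ} (hf : Integrable f) :
    ∫ x, f x = ∑' k : ℤ, ∫ x in Set.Ioc (0 : ℝ) 1, f (x + k) := by
  rw [← setIntegral_univ, ← iUnion_Ioc_intCast ℝ,
    integral_iUnion (fun _ => measurableSet_Ioc) (Set.pairwise_disjoint_Ioc_intCast ℝ)
      hf.integrableOn]
  refine tsum_congr fun k => ?_
  exact ((restrict_Ioc_int_map k).integral_comp (measurableEmbedding_addRight (k : ℝ)) f).symm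

/-- Periodization against a function whose squares at the points `w + k` sum to one. -/
theorem integral_of_periodization {F N G : ℝ → ℂ}
    (hF : ∀ᵐ w : ℝ, HasSum (fun k : ℤ => ‖F (w + k)‖ ^ 2) 1) (hGm : AEStronglyMeasurable G volume)
    (hNper : ∀ (w : ℝ) (k : ℤ), N (w + k) = N w) (hNint : IntegrableOn N (Set.Ioc 0 1))
    (hGN : ∀ᵐ w : ℝ, G w = N w * (‖F w‖ ^ 2 : ℝ)) :
    Integrable G ∧ ∫ w, G w = ∫ w in Set.Ioc 0 1, N w := by
  have hG' : ∀ᵐ w : ℝ, ∀ k : ℤ, G (w + k) = N w * (‖F (w + k)‖ ^ 2 : ℝ) := by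
    filter_upwards [ae_forall_add_int hGN] with w hw k
    rw [hw, hNper]
  have hGk : ∀ k : ℤ, AEStronglyMeasurable (fun w => G (w + k))
      (volume.restrict (Set.Ioc (0 : ℝ) 1)) := fun k =>
    (hGm.comp_measurePreserving (measurePreserving_add_right volume (k : ℝ))).restrict
  -- Folding onto one period leaves |N|, because the squares sum to one. This gives both the
  -- integrability of G and the interchange for its integral.
  have hsum : ∑' k : ℤ, ∫⁻ w in Set.Ioc (0 : ℝ) 1, ‖G (w + k)‖ₑ
      = ∫⁻ w in Set.Ioc (0 : ℝ) 1, ‖N w‖ₑ := by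
    rw [← lintegral_tsum fun k => (hGk k).enorm]
    refine lintegral_congr_ae (ae_restrict_of_ae ?_)
    filter_upwards [hG', hF] with w hw hFw
    have : ∀ k : ℤ, ‖G (w + k)‖ₑ = ‖N w‖ₑ * ENNReal.ofReal (‖F (w + k)‖ ^ 2) := fun k => by
      rw [hw k, enorm_mul, ← ofReal_norm ((‖F (w + k)‖ ^ 2 : ℝ) : ℂ), Complex.norm_real,
        Real.norm_of_nonneg (by positivity)]
    simp only [this]
    rw [ENNReal.tsum_mul_left, ← ENNReal.ofReal_tsum_of_nonneg (fun _ => by positivity)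
      hFw.summable,
      hFw.tsum_eq]
    simp
  have hGint : Integrable G := by
    refine ⟨hGm, ?_⟩
    rw [HasFiniteIntegral, lintegral_eq_tsum_Ioc, hsum]
    exact hNint.2
  refine ⟨hGint, ?_⟩
  rw [integral_eq_tsum_Ioc hGint, ← integral_tsum hGk (by rw [hsum]; exact hNint.2.ne)]
  refine integral_congr_ae (ae_restrict_of_ae ?_)
  filter_upwards [hG', hF] with w hw hFw
  simp only [hw]
  rw [tsum_mul_left, ← Complex.ofReal_tsum, hFw.tsum_eq]
  simp

theorem fourier_conj_neg (g : ℝ → ℂ) (w : ℝ) : 𝓕 (fun x => conj (g (-x))) w = conj (𝓕 g w) := by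
  rw [Real.fourier_real_eq_integral_exp_smul, Real.fourier_real_eq_integral_exp_smul,
    ← integral_conj, ← integral_neg_eq_self]
  refine integral_congr_ae (ae_of_all _ fun x => ?_)
  simp only [smul_eq_mul, map_mul, ← Complex.exp_conj, neg_neg, Complex.conj_I, Complex.conj_ofReal]
  congr 2
  push_cast; ring

theorem continuous_fourier {f : ℝ → ℂ} (hf : Integrable f) : Continuous (𝓕 f) :=
  VectorFourier.fourierIntegral_continuous Real.continuous_fourierChar
    (by exact continuous_inner) hf

/-- The correlation of two functions as an integral over the frequency domain. -/
theorem shiftCoeff_eq_integral_fourier {f g : ℝ → ℂ} {C : ℝ} (hfi : Integrable f)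
    (hg : Continuous g) (hgi : Integrable g) (hC : ∀ x, ‖g x‖ ≤ C)
    (hint : Integrable fun w => 𝓕 f w * conj (𝓕 g w)) (k : ℤ) :
    shiftCoeff g f k
      = ∫ w : ℝ, 𝓕 f w * conj (𝓕 g w) * Complex.exp (2 * Real.pi * Complex.I * k * w) := by
  -- The correlation is the convolution of f with the conjugate reflection of g, whose transform is
  -- conj(𝓕 g). Fourier inversion then holds at every point, the convolution being continuous.
  set g' : ℝ → ℂ := fun x => conj (g (-x)) with hg'
  have hg'c : Continuous g' := by fun_prop
  have hg'i : Integrable g' :=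
    (LinearIsometryEquiv.integrable_comp_iff (RCLike.conjLIE (K := ℂ))).2 hgi.comp_neg
  have hbdd : BddAbove (Set.range fun x => ‖g' x‖) := by
    refine ⟨C, ?_⟩
    rintro _ ⟨x, rfl⟩
    simpa [g'] using hC (-x)
  set c : ℝ → ℂ := convolution f g' (ContinuousLinearMap.mul ℂ ℂ) volume with hc
  have hcc : Continuous c := hbdd.continuous_convolution_right_of_integrable _ hfi hg'c
  have hci : Integrable c := hfi.integrable_convolution _ hg'i
  have hcF : 𝓕 c = fun w => 𝓕 f w * conj (𝓕 g w) := by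
    ext w
    rw [hc, Real.fourier_mul_convolution_eq hfi hg'i, fourier_conj_neg]
  have hinv := congrFun (hcc.fourierInv_fourier_eq hci (by rw [hcF]; exact hint)) k
  rw [hcF, Real.fourierInv_eq'] at hinv
  have : shiftCoeff g f k = c k := by
    simp only [shiftCoeff, hc, convolution_def, ContinuousLinearMap.mul_apply', g']
    refine integral_congr_ae (ae_of_all _ fun x => ?_)
    simp only [smul_eq_mul, neg_sub]
    ring
  rw [this, ← hinv]
  refine integral_congr_ae (ae_of_all _ fun w => ?_)
  simp only [smul_eq_mul]
  rw [mul_comm]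
  congr 2
  simp
  ring

theorem fourier_comp_div_two (f : ℝ → ℂ) (w : ℝ) :
    𝓕 (fun x => f (x / 2)) w = 2 * 𝓕 f (2 * w) := by
  rw [Real.fourier_real_eq_integral_exp_smul, Real.fourier_real_eq_integral_exp_smul]
  have := Measure.integral_comp_div
    (fun y => Complex.exp (↑(-2 * Real.pi * y * (2 * w)) * Complex.I) • f y) 2
  rw [abs_of_pos two_pos, Complex.real_smul] at this
  rw [← Complex.ofReal_ofNat, ← this]
  refine integral_congr_ae (ae_of_all _ fun x => ?_)
  simp only
  congr 4
  ring

/-- A square integrable function on the unit interval with absolutely summable Fourier coefficients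
is the sum of its Fourier series almost everywhere. -/
theorem hasSum_fourierSeries_of_summable {M : ℝ → ℂ}
    (hM : MemLp M 2 (volume.restrict (Set.Ioc 0 1))) {b : ℤ → ℂ}
    (hb : ∀ k : ℤ, b k =
      ∫ w : ℝ in Set.Ioc 0 1, M w * Complex.exp (2 * Real.pi * Complex.I * k * w))
    (hs : Summable fun k => ‖b k‖) :
    ∀ᵐ w : ℝ ∂volume.restrict (Set.Ioc 0 1),
      HasSum (fun k : ℤ => b k * Complex.exp (-(2 * Real.pi * Complex.I * k * w))) (M w) := by
  have hM' : MemLp M 2 (volume.restrict (Set.Ioc 0 (0 + 1))) := by rwa [zero_add]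
  have hL := hM'.memLp_liftIoc.haarAddCircle
  set f : Lp ℂ 2 (@AddCircle.haarAddCircle (1 : ℝ) _) := hL.toLp with hf
  -- The index changes sign: `fourierCoeff` integrates against the conjugate character, `b` against
  -- the character itself.
  have hcoef : ∀ k, fourierCoeff f k = b (-k) := by
    intro k
    rw [fourierCoeff_congr_ae hL.coeFn_toLp, fourierCoeff_liftIoc_eq,
      fourierCoeffOn_eq_integral, hb,
      intervalIntegral.integral_of_le (by norm_num)]
    simp only [zero_add, sub_zero, div_one, one_smul]
    refine integral_congr_ae (ae_of_all _ fun x => ?_)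
    simp only [smul_eq_mul]
    rw [mul_comm]
    congr 1
    rw [fourier_coe_apply]
    simp
  have hsn : Summable fun k => ‖b (-k)‖ := (Equiv.neg ℤ).summable_iff.2 hs
  have hsC : Summable fun k : ℤ => b (-k) • (fourier k : C(AddCircle (1 : ℝ), ℂ)) := by
    refine .of_norm ?_
    simpa [norm_smul, fourier_norm] using hsn
  obtain ⟨g, hg⟩ := hsC
  have h1 := hasSum_fourier_series_L2 f
  simp only [hcoef] at h1
  have h2 := (ContinuousMap.toLp (E := ℂ) 2 (@AddCircle.haarAddCircle (1 : ℝ) _) ℂ).hasSum hg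
  simp only [map_smul] at h2
  have hfg := h1.unique h2
  -- The series converges to g uniformly and to f in L₂, so f is the class of g; only this
  -- identification is almost everywhere.
  have hae : AddCircle.liftIoc 1 0 M =ᵐ[@AddCircle.haarAddCircle (1 : ℝ) _] g := by
    refine hL.coeFn_toLp.symm.trans ?_
    rw [← hf, hfg]
    exact ContinuousMap.coeFn_toLp _ g
  have hvol : AddCircle.liftIoc 1 0 M =ᵐ[volume] g := by
    have hv : (volume : Measure (AddCircle (1 : ℝ))) = AddCircle.haarAddCircle := by
      rw [AddCircle.volume_eq_smul_haarAddCircle]; simp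
    rw [hv]; exact hae
  have hmk := (AddCircle.measurePreserving_mk 1 0).quasiMeasurePreserving.ae hvol
  rw [zero_add] at hmk
  filter_upwards [hmk, ae_restrict_mem measurableSet_Ioc] with w hw hwm
  rw [AddCircle.liftIoc_coe_apply (by rwa [zero_add])] at hw
  rw [hw]
  have h3 := (ContinuousMap.evalCLM ℂ (w : AddCircle (1 : ℝ))).hasSum hg
  have h4 := (Equiv.neg ℤ).hasSum_iff.2 h3
  convert h4 using 1
  · ext k
    simp only [Function.comp, Equiv.neg_apply, neg_neg, map_smul, ContinuousMap.evalCLM_apply,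
      fourier_coe_apply, smul_eq_mul]
    congr 2
    push_cast
    ring
  · rfl

theorem fourier_comp_sub (f : ℝ → ℂ) (a w : ℝ) :
    𝓕 (fun x => f (x - a)) w = Complex.exp (-(2 * Real.pi * Complex.I * a * w)) * 𝓕 f w := by
  rw [Real.fourier_real_eq_integral_exp_smul, Real.fourier_real_eq_integral_exp_smul,
    ← integral_const_mul, ← integral_add_right_eq_self _ a]
  refine integral_congr_ae (ae_of_all _ fun x => ?_)
  simp only [smul_eq_mul, add_sub_cancel_right]
  rw [← mul_assoc, ← Complex.exp_add]
  congr 2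
  push_cast; ring

theorem integrable_exp_smul {f : ℝ → ℂ} (hf : Integrable f) (w : ℝ) :
    Integrable fun x : ℝ => Complex.exp (↑(-2 * Real.pi * x * w) * Complex.I) • f x := by
  simp only [smul_eq_mul]
  have hc : Continuous fun x : ℝ => Complex.exp (↑(-2 * Real.pi * x * w) * Complex.I) := by fun_prop
  refine hf.bdd_mul (c := 1) hc.aestronglyMeasurable (ae_of_all _ fun x => ?_)
  rw [Complex.norm_exp_ofReal_mul_I]

/-- A continuous integrable function is determined by its Fourier transform. -/
theorem eq_of_fourier_ae_eq {f g : ℝ → ℂ} (hf : Continuous f) (hfi : Integrable f)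
    (hg : Continuous g) (hgi : Integrable g) (h : 𝓕 f =ᵐ[volume] 𝓕 g) : f = g := by
  have h0 : 𝓕 (f - g) =ᵐ[volume] fun _ => (0 : ℂ) := by
    filter_upwards [h] with w hw
    have e : 𝓕 (f - g) w = 𝓕 f w - 𝓕 g w := by
      rw [Real.fourier_eq, Real.fourier_eq, Real.fourier_eq,
        ← integral_sub ((Real.fourierIntegral_convergent_iff w).2 hfi)
          ((Real.fourierIntegral_convergent_iff w).2 hgi)]
      simp only [Pi.sub_apply, smul_sub]
    rw [e, hw, sub_self]
  have hinv := (hf.sub hg).fourierInv_fourier_eq (hfi.sub hgi)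
    ((integrable_zero ℝ ℂ volume).congr h0.symm)
  have hz : f - g = 0 := by
    rw [← hinv]
    ext x
    rw [Real.fourierInv_congr_ae h0, Real.fourierInv_eq]
    simp
  exact sub_eq_zero.1 hz

/-- A refinement equation in the frequency domain yields one in the time domain. -/
theorem hasSum_refinement {f phi B : ℝ → ℂ} {b : ℤ → ℂ} {C : ℝ} (hb : Summable fun k => ‖b k‖)
    (hB : ∀ᵐ w : ℝ,
      HasSum (fun k : ℤ => b k * Complex.exp (-(2 * Real.pi * Complex.I * k * w))) (B w))
    (hfB : ∀ᵐ w : ℝ, 𝓕 f (2 * w) = B w * 𝓕 phi w)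
    (hf : Continuous f) (hfi : Integrable f) (hphi : Continuous phi) (hphii : Integrable phi)
    (hC : ∀ x, ‖phi x‖ ≤ C) (x : ℝ) :
    HasSum (fun l : ℤ => 2 * b l * phi (2 * x - l)) (f x) := by
  have hbd : ∀ (l : ℤ) (x : ℝ), ‖b l * phi (x - l)‖ ≤ ‖b l‖ * C := fun l x => by
    rw [norm_mul]; gcongr; exact hC _
  have hp : ∀ x : ℝ, Summable fun l : ℤ => b l * phi (x - l) := fun x =>
    .of_norm_bounded (hb.mul_right C) fun l => hbd l x
  set p : ℝ → ℂ := fun x => ∑' l : ℤ, b l * phi (x - l) with hpdef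
  have hpc : Continuous p :=
    continuous_tsum (fun l => by fun_prop) (hb.mul_right C) hbd
  have hterm : ∀ l : ℤ, Integrable fun x : ℝ => b l * phi (x - l) := fun l =>
    (hphii.comp_sub_right (l : ℝ)).const_mul (b l)
  have hnorm : ∀ l : ℤ, ∫ x : ℝ, ‖b l * phi (x - l)‖ = ‖b l‖ * ∫ x, ‖phi x‖ := fun l => by
    simp only [norm_mul]
    rw [integral_const_mul, integral_sub_right_eq_self (fun x => ‖phi x‖) (l : ℝ)]
  have hpi : Integrable p := by
    refine ⟨hpc.aestronglyMeasurable, ?_⟩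
    calc ∫⁻ x, ‖p x‖ₑ ≤ ∫⁻ x : ℝ, ∑' l : ℤ, ‖b l * phi (x - l)‖ₑ :=
          lintegral_mono fun x => enorm_tsum_le_tsum_enorm
      _ = ∑' l : ℤ, ∫⁻ x : ℝ, ‖b l * phi (x - l)‖ₑ :=
          lintegral_tsum fun l => (hterm l).1.enorm
      _ = ∑' l : ℤ, ENNReal.ofReal (‖b l‖ * ∫ x, ‖phi x‖) := by
          refine tsum_congr fun l => ?_
          rw [← hnorm, ofReal_integral_norm_eq_lintegral_enorm (hterm l)]
      _ < ∞ := by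
          rw [← ENNReal.ofReal_tsum_of_nonneg (fun l => by positivity)
            (hb.mul_right _)]
          exact ENNReal.ofReal_lt_top
  have hpF : ∀ w : ℝ, HasSum (fun l : ℤ => b l * Complex.exp (-(2 * Real.pi * Complex.I * l * w))
      * 𝓕 phi w) (𝓕 p w) := by
    intro w
    have hi : ∀ l : ℤ, Integrable fun x : ℝ =>
        Complex.exp (↑(-2 * Real.pi * x * w) * Complex.I) • (b l * phi (x - l)) := fun l =>
      integrable_exp_smul (hterm l) w
    have hn : Summable fun l : ℤ => ∫ x : ℝ,
        ‖Complex.exp (↑(-2 * Real.pi * x * w) * Complex.I) • (b l * phi (x - l))‖ := by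
      simp only [norm_smul, Complex.norm_exp_ofReal_mul_I, one_mul, hnorm]
      exact hb.mul_right _
    have := hasSum_integral_of_summable_integral_norm hi hn
    refine (congrArg₂ (fun a b => HasSum a b) ?_ ?_).mpr this
    · ext l
      have e := fourier_comp_sub phi l w
      rw [Real.fourier_real_eq_integral_exp_smul] at e
      rw [mul_assoc]
      push_cast at e ⊢
      rw [← e, ← integral_const_mul]
      refine integral_congr_ae (ae_of_all _ fun x => ?_)
      simp only [smul_eq_mul]
      ring
    · rw [Real.fourier_real_eq_integral_exp_smul]
      refine integral_congr_ae (ae_of_all _ fun x => ?_)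
      simp only [hpdef]
      rw [← (hp x).tsum_const_smul]
  -- Both sides have transform B · 𝓕 phi almost everywhere; continuity upgrades this to equality at
  -- every point.
  have heq : p = fun x => 1 / 2 * f (x / 2) := by
    refine eq_of_fourier_ae_eq hpc hpi (by fun_prop)
      ((hfi.comp_div two_ne_zero).const_mul _) ?_
    filter_upwards [hB, hfB] with w h1 h2
    have e : 𝓕 (fun x => 1 / 2 * f (x / 2)) w = 1 / 2 * 𝓕 (fun x => f (x / 2)) w := by
      rw [Real.fourier_eq, Real.fourier_eq, ← integral_const_mul]
      refine integral_congr_ae (ae_of_all _ fun x => ?_)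
      simp only [Circle.smul_def, smul_eq_mul]
      ring
    rw [e, fourier_comp_div_two, h2, (hpF w).unique (h1.mul_right _)]
    ring
  have h2x := ((hp (2 * x)).hasSum.mul_left 2)
  have e2 : ∑' l : ℤ, b l * phi (2 * x - l) = 1 / 2 * f (2 * x / 2) := congrFun heq (2 * x)
  rw [e2, show 2 * x / 2 = x by ring] at h2x
  simpa [mul_assoc] using h2x

/-! ### From the angular-frequency hypotheses to pointwise refinement equations -/

theorem fourierHat_eq (f : ℝ → ℂ) (w : ℝ) : fourierHat f (2 * Real.pi * w) = 𝓕 f w := by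
  rw [Real.fourier_real_eq_integral_exp_smul, fourierHat]
  refine integral_congr_ae (ae_of_all _ fun x => ?_)
  simp only [smul_eq_mul]
  congr 2
  push_cast; ring

theorem ae_comp_mul_left {P : ℝ → Prop} {a : ℝ} (ha : a ≠ 0) (h : ∀ᵐ x, P x) :
    ∀ᵐ x : ℝ, P (a * x) := by
  have : Measure.QuasiMeasurePreserving (fun x : ℝ => a * x) volume volume := by
    refine ⟨by fun_prop, ?_⟩
    rw [Real.map_volume_mul_left ha]
    exact Measure.smul_absolutelyContinuous
  exact this.ae h

theorem memLp_comp_mul_two_pi {m : ℝ → ℂ}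
    (hm : MemLp m 2 (volume.restrict (Set.Icc 0 (2 * Real.pi)))) :
    MemLp (fun w => m (2 * Real.pi * w)) 2 (volume.restrict (Set.Ioc 0 1)) := by
  have hpi : (0 : ℝ) < 2 * Real.pi := Real.two_pi_pos
  have hemb : MeasurableEmbedding fun w : ℝ => 2 * Real.pi * w :=
    measurableEmbedding_mulLeft₀ hpi.ne'
  have hpre : (fun w : ℝ => 2 * Real.pi * w) ⁻¹' Set.Icc 0 (2 * Real.pi) = Set.Icc 0 1 := by
    ext w
    simp only [Set.mem_preimage, Set.mem_Icc]
    constructor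
    · rintro ⟨h1, h2⟩
      exact ⟨by nlinarith, by nlinarith⟩
    · rintro ⟨h1, h2⟩
      exact ⟨by positivity, by nlinarith⟩
  have hmap : (volume.restrict (Set.Icc (0 : ℝ) 1)).map (fun w : ℝ => 2 * Real.pi * w)
      = ENNReal.ofReal |(2 * Real.pi)⁻¹| • volume.restrict (Set.Icc 0 (2 * Real.pi)) := by
    rw [← hpre, ← hemb.restrict_map, Real.map_volume_mul_left hpi.ne', Measure.restrict_smul]
  have h1 : MemLp m 2 ((volume.restrict (Set.Icc (0 : ℝ) 1)).map fun w : ℝ => 2 * Real.pi * w) := by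
    rw [hmap]
    exact hm.smul_measure ENNReal.ofReal_ne_top
  exact ((hemb.memLp_map_measure_iff).1 h1).mono_measure
    (Measure.restrict_mono Set.Ioc_subset_Icc_self le_rfl)

theorem integral_Ioc_exp (k : ℤ) :
    ∫ v : ℝ in Set.Ioc 0 1, Complex.exp (2 * Real.pi * Complex.I * k * v)
      = if k = 0 then 1 else 0 := by
  split_ifs with hk
  · simp [hk]
  · have hc : 2 * Real.pi * Complex.I * k ≠ 0 :=
      mul_ne_zero Complex.two_pi_I_ne_zero (by exact_mod_cast hk)
    rw [← intervalIntegral.integral_of_le zero_le_one, integral_exp_mul_complex hc,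
      Complex.ofReal_one, mul_one, mul_comm _ (k : ℂ), Complex.exp_int_mul_two_pi_mul_I]
    simp

/-- The filter is the sequence of Fourier coefficients of m₀. Time-domain correlations identify
these with inner products of phi(·/2) against translates of phi. They are therefore summable, and
`hasSum_refinement` transfers the frequency relations. -/
theorem exists_isRefinable {phi psi : ℝ → ℂ} {w : ℤ → ℝ} (hphi : IsFWavelet phi)
    (hpsi : IsMWavelet phi psi) (hphi_cont : Continuous phi) (hpsi_cont : Continuous psi)
    (hw : HasWienerBound phi w) :
    ∃ h, IsRefinable phi w h ∧
      ∀ x, HasSum (fun l : ℤ => 2 * mirror h l * phi (2 * x - l)) (psi x) := by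
  obtain ⟨-, hpsii, m, hm, hpsim⟩ := hpsi
  have hphii := hphi.integrable
  have hpi : (2 * Real.pi) ≠ 0 := Real.two_pi_pos.ne'
  set F := 𝓕 phi with hFdef
  have hFc : Continuous F := continuous_fourier hphii
  set M : ℝ → ℂ := fun v => m (2 * Real.pi * v) with hMdef
  have hMper : ∀ (v : ℝ) (k : ℤ), M (v + k) = M v := fun v k => by
    simp only [hMdef]
    rw [mul_add, mul_comm (2 * Real.pi) (k : ℝ)]
    exact hm.periodic.int_mul k _
  have hML : MemLp M 2 (volume.restrict (Set.Ioc 0 1)) := memLp_comp_mul_two_pi hm.memLp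
  have hF1 : ∀ᵐ v : ℝ, HasSum (fun k : ℤ => ‖F (v + k)‖ ^ 2) 1 := by
    filter_upwards [ae_comp_mul_left hpi hphi.sum_hat] with v hv
    convert hv using 4 with k
    rw [hFdef, ← fourierHat_eq, mul_add]
  -- The substitution y = 4πv makes y/2 equal to 2πv, the unit-period variable.
  have h4 : (2 * (2 * Real.pi)) ≠ 0 := by positivity
  have hscal : ∀ᵐ v : ℝ, F (2 * v) = M v * F v := by
    filter_upwards [ae_comp_mul_left h4 hm.scaling] with v hv
    rw [show 2 * (2 * Real.pi) * v / 2 = 2 * Real.pi * v by ring,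
      show 2 * (2 * Real.pi) * v = 2 * Real.pi * (2 * v) by ring, fourierHat_eq,
      fourierHat_eq] at hv
    exact hv
  have hpsiF : ∀ᵐ v : ℝ, 𝓕 psi (2 * v)
      = conj (M (v + 1 / 2)) * Complex.exp (-(2 * Real.pi * Complex.I * v)) * F v := by
    filter_upwards [ae_comp_mul_left h4 hpsim] with v hv
    rw [show 2 * (2 * Real.pi) * v / 2 = 2 * Real.pi * v by ring,
      show 2 * (2 * Real.pi) * v = 2 * Real.pi * (2 * v) by ring, fourierHat_eq,
      fourierHat_eq] at hv
    rw [hv, hMdef]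
    simp only
    congr 3
    · congr 1; ring
    · push_cast; ring
  have hchar : ∀ (k : ℤ) (v : ℝ) (n : ℤ), Complex.exp (2 * Real.pi * Complex.I * k * (v + n : ℝ))
      = Complex.exp (2 * Real.pi * Complex.I * k * v) := fun k v n => by
    rw [Complex.ofReal_add, mul_add, Complex.exp_add]
    have : 2 * Real.pi * Complex.I * k * ((n : ℝ) : ℂ)
        = (k * n : ℤ) * (2 * Real.pi * Complex.I) := by
      push_cast; ring
    rw [this, Complex.exp_int_mul_two_pi_mul_I, mul_one]
  have hcnorm : ∀ (k : ℤ) (v : ℝ), ‖Complex.exp (2 * Real.pi * Complex.I * k * v)‖ = 1 := by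
    intro k v
    rw [show 2 * Real.pi * Complex.I * k * v = ((2 * Real.pi * k * v : ℝ) : ℂ) * Complex.I by
      push_cast; ring, Complex.norm_exp_ofReal_mul_I]
  have horth : ∀ k : ℤ, shiftCoeff phi phi k = if k = 0 then 1 else 0 := by
    have hper1 : ∀ k : ℤ, (Integrable fun v : ℝ =>
        F v * conj (F v) * Complex.exp (2 * Real.pi * Complex.I * k * v)) ∧
        ∫ v : ℝ, F v * conj (F v) * Complex.exp (2 * Real.pi * Complex.I * k * v)
          = ∫ v : ℝ in Set.Ioc 0 1, Complex.exp (2 * Real.pi * Complex.I * k * v) := by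
      intro k
      refine integral_of_periodization
        (N := fun v => Complex.exp (2 * Real.pi * Complex.I * k * v)) hF1
        (Continuous.aestronglyMeasurable (by fun_prop)) (fun v n => hchar k v n) ?_ ?_
      · exact (Continuous.integrableOn_Icc (by fun_prop)).mono_set Set.Ioc_subset_Icc_self
      · refine ae_of_all _ fun v => ?_
        rw [Complex.mul_conj, Complex.normSq_eq_norm_sq, mul_comm]
    intro k
    have h0 := (hper1 0).1
    simp only [Int.cast_zero, mul_zero, zero_mul, Complex.exp_zero, mul_one] at h0
    rw [shiftCoeff_eq_integral_fourier hphii hphi_cont hphii hw.norm_le_tsum h0, (hper1 k).2]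
    exact integral_Ioc_exp k
  set h : ℤ → ℂ := fun k =>
    ∫ v : ℝ in Set.Ioc 0 1, M v * Complex.exp (2 * Real.pi * Complex.I * k * v) with hh
  have hMint : IntegrableOn M (Set.Ioc 0 1) := hML.integrable (by norm_num)
  have hper2 : ∀ k : ℤ, (Integrable fun v : ℝ =>
      F (2 * v) * conj (F v) * Complex.exp (2 * Real.pi * Complex.I * k * v)) ∧
      ∫ v : ℝ, F (2 * v) * conj (F v) * Complex.exp (2 * Real.pi * Complex.I * k * v) = h k := by
    intro k
    refine integral_of_periodization
      (N := fun v => M v * Complex.exp (2 * Real.pi * Complex.I * k * v)) hF1 (by fun_prop)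
      (fun v n => by rw [hMper, hchar]) ?_ ?_
    · exact hMint.mul_bdd (c := 1) (Continuous.aestronglyMeasurable (by fun_prop))
        (ae_of_all _ fun v => (hcnorm k v).le)
    · filter_upwards [hscal] with v hv
      rw [hv, mul_assoc (M v), Complex.mul_conj, Complex.normSq_eq_norm_sq]
      ring
  have hcoef : ∀ k, shiftCoeff phi (fun s => phi (s / 2)) k = 2 * h k := by
    intro k
    have h0 := (hper2 0).1
    simp only [Int.cast_zero, mul_zero, zero_mul, Complex.exp_zero, mul_one] at h0
    rw [shiftCoeff_eq_integral_fourier (hphii.comp_div two_ne_zero) hphi_cont hphii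
      hw.norm_le_tsum, ← (hper2 k).2, ← integral_const_mul]
    · refine integral_congr_ae (ae_of_all _ fun v => ?_)
      simp only [fourier_comp_div_two, ← hFdef]
      ring
    · refine (h0.const_mul 2).congr (ae_of_all _ fun v => ?_)
      simp only [fourier_comp_div_two, ← hFdef]
      ring
  have hsum : Summable fun k => ‖h k‖ := by
    have hs := (hw.summable_integral_norm hphi_cont (hphii.comp_div two_ne_zero)).2
    refine .of_nonneg_of_le (fun _ => norm_nonneg _) (fun k => ?_) hs
    have e : h k = 1 / 2 * shiftCoeff phi (fun s => phi (s / 2)) k := by rw [hcoef]; ring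
    have := norm_integral_le_integral_norm (μ := volume)
      fun x : ℝ => conj (phi (x - k)) • phi (x / 2)
    rw [e, norm_mul]
    refine le_trans ?_ this
    rw [shiftCoeff]
    refine mul_le_of_le_one_left (norm_nonneg _) (by norm_num)
  have hMs : ∀ᵐ v : ℝ,
      HasSum (fun k : ℤ => h k * Complex.exp (-(2 * Real.pi * Complex.I * k * v))) (M v) := by
    refine ae_of_ae_restrict_Ioc (fun v n hv => ?_)
      (hasSum_fourierSeries_of_summable hML (fun _ => rfl) hsum)
    simpa only [hMper, Complex.exp_neg, hchar] using hv
  refine ⟨h, ⟨hphi_cont, hphii, hw, hsum,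
    hasSum_refinement hsum hMs hscal hphi_cont hphii hphi_cont hphii hw.norm_le_tsum, hcoef, horth,
    ?_⟩, ?_⟩
  · have := hphi.hat_zero_ne
    simpa [fourierHat] using this
  · refine hasSum_refinement (summable_norm_mirror hsum) (B := fun v =>
      conj (M (v + 1 / 2)) * Complex.exp (-(2 * Real.pi * Complex.I * v))) ?_ hpsiF hpsi_cont hpsii
      hphi_cont hphii hw.norm_le_tsum
    -- The half shift produces the sign (-1)^k. After conjugation, k = 1 - l absorbs exp(-2πiv),
    -- which is the form of `mirror`.
    have hshift : ∀ᵐ v : ℝ, HasSum (fun k : ℤ => h k *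
        Complex.exp (-(2 * Real.pi * Complex.I * k * (v + 1 / 2 : ℝ)))) (M (v + 1 / 2)) :=
      (measurePreserving_add_right volume (1 / 2 : ℝ)).quasiMeasurePreserving.ae hMs
    filter_upwards [hshift] with v hv
    have h1 := (hv.map (starRingEnd ℂ) Complex.continuous_conj).mul_right
      (Complex.exp (-(2 * Real.pi * Complex.I * v)))
    have h2 := (Equiv.subLeft (1 : ℤ)).hasSum_iff.2 h1
    refine (congrArg (fun a => HasSum a _) ?_).mpr h2
    ext l
    simp only [Function.comp, Equiv.subLeft_apply, map_mul, mirror, ← Complex.exp_conj]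
    have hpow : ((-1 : ℂ)) ^ (1 - l) = Complex.exp (Real.pi * Complex.I * (1 - l : ℤ)) := by
      rw [mul_comm, Complex.exp_int_mul, Complex.exp_pi_mul_I]
    rw [hpow, mul_comm (Complex.exp _) (conj _), mul_assoc (conj (h (1 - l))),
      mul_assoc (conj (h (1 - l))), ← Complex.exp_add,
      ← Complex.exp_add]
    congr 2
    simp only [map_neg, map_mul, Complex.conj_I, Complex.conj_ofReal, map_ofNat, map_intCast]
    push_cast
    ring


/-! ### From exponential moments to curves in L₂(Ω) -/

section Probability

variable {Ω : Type*} [MeasurableSpace Ω] {P : Measure Ω} {vphi : ℝ → ℝ} {ξ η : Ω → ℝ}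

theorem IsOrliczNFunction.le_of_abs_le (hv : IsOrliczNFunction vphi) {x y : ℝ} (h : |x| ≤ |y|) :
    vphi x ≤ vphi y := by
  have habs : ∀ x, vphi |x| = vphi x := fun x => by
    rcases abs_choice x with h | h <;> rw [h]
    exact hv.even x
  have hnn : ∀ x, 0 ≤ vphi x := fun x => by
    have := hv.convex.2 (Set.mem_univ x) (Set.mem_univ (-x)) 
      (show (0 : ℝ) ≤ 1 / 2 by norm_num) (show (0 : ℝ) ≤ 1 / 2 by norm_num) (by norm_num)
    simp only [smul_eq_mul, hv.even] at this
    rw [show 1 / 2 * x + 1 / 2 * -x = 0 by ring, hv.zero] at this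
    linarith
  rw [← habs x, ← habs y]
  rcases (abs_nonneg x).eq_or_lt with h0 | h0
  · rw [← h0, hv.zero]; exact hnn _
  · exact hv.increasing.monotoneOn h0 (h0.trans_le h) h

theorem ExpMomentBound.mono (hv : IsOrliczNFunction vphi) {a b : ℝ} (ha : 0 ≤ a) (hab : a ≤ b)
    (h : ExpMomentBound vphi P ξ a) : ExpMomentBound vphi P ξ b := fun l =>
  ⟨(h l).1, (h l).2.trans (Real.exp_le_exp.2 (hv.le_of_abs_le (by
    rw [abs_mul, abs_mul, abs_of_nonneg ha, abs_of_nonneg (ha.trans hab)]; gcongr)))⟩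

/-- By xy ≤ (x² + y²)/2 applied to the exponentials, no independence is needed; the squares double
the frequency, hence 2a. -/
theorem ExpMomentBound.sub (hv : IsOrliczNFunction vphi) {a : ℝ}
    (hξm : AEStronglyMeasurable ξ P) (hηm : AEStronglyMeasurable η P)
    (hξ : ExpMomentBound vphi P ξ a) (hη : ExpMomentBound vphi P η a) :
    ExpMomentBound vphi P (fun ω => ξ ω - η ω) (2 * a) := by
  intro l
  obtain ⟨i1, b1⟩ := hξ (2 * l)
  obtain ⟨i2, b2⟩ := hη (-(2 * l))
  have hle : ∀ ω, Real.exp (l * (ξ ω - η ω))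
      ≤ (Real.exp (2 * l * ξ ω) + Real.exp (-(2 * l) * η ω)) / 2 := fun ω => by
    have e1 : Real.exp (l * (ξ ω - η ω)) = Real.exp (l * ξ ω) * Real.exp (-(l * η ω)) := by
      rw [← Real.exp_add]; ring_nf
    have e2 : Real.exp (2 * l * ξ ω) = Real.exp (l * ξ ω) ^ 2 := by
      rw [← Real.exp_nat_mul]; push_cast; ring_nf
    have e3 : Real.exp (-(2 * l) * η ω) = Real.exp (-(l * η ω)) ^ 2 := by
      rw [← Real.exp_nat_mul]; push_cast; ring_nf
    rw [e1, e2, e3]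
    nlinarith [sq_nonneg (Real.exp (l * ξ ω) - Real.exp (-(l * η ω)))]
  have hsum : Integrable
      (fun ω => (Real.exp (2 * l * ξ ω) + Real.exp (-(2 * l) * η ω)) / 2) P :=
    (i1.add i2).div_const 2
  have hi : Integrable (fun ω => Real.exp (l * (ξ ω - η ω))) P := by
    refine hsum.mono' ?_ (ae_of_all _ fun ω => ?_)
    · exact Real.continuous_exp.comp_aestronglyMeasurable ((hξm.sub hηm).const_mul l)
    · rw [Real.norm_of_nonneg (Real.exp_pos _).le]; exact hle ω
  refine ⟨hi, (integral_mono hi hsum hle).trans ?_⟩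
  rw [integral_div, integral_add i1 i2]
  rw [show a * (2 * l) = 2 * a * l by ring] at b1
  rw [show a * -(2 * l) = -(2 * a * l) by ring, hv.even] at b2
  linarith

/-- Test the moment bound at ±1/a, where its right side is exp(vphi 1), and use y² ≤ 2(e^y + e^{-y})
with y = ξ/a. -/
theorem ExpMomentBound.eLpNorm_le (hv : IsOrliczNFunction vphi) {a : ℝ} (ha : 0 < a)
    (hm : AEStronglyMeasurable ξ P) (h : ExpMomentBound vphi P ξ a) :
    eLpNorm ξ 2 P ≤ ENNReal.ofReal (2 * Real.sqrt (Real.exp (vphi 1)) * a) := by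
  obtain ⟨i1, b1⟩ := h a⁻¹
  obtain ⟨i2, b2⟩ := h (-a⁻¹)
  rw [mul_inv_cancel₀ ha.ne'] at b1
  rw [mul_neg, mul_inv_cancel₀ ha.ne', hv.even] at b2
  have hle : ∀ ω, ξ ω ^ 2
      ≤ 2 * a ^ 2 * (Real.exp (a⁻¹ * ξ ω) + Real.exp (-a⁻¹ * ξ ω)) := fun ω => by
    set y := a⁻¹ * ξ ω with hy
    have hξ : ξ ω = a * y := by rw [hy]; field_simp
    have h1 := Real.quadratic_le_exp_of_nonneg (abs_nonneg y)
    have h2 : Real.exp |y| ≤ Real.exp y + Real.exp (-y) := by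
      rcases abs_choice y with h | h <;> rw [h] <;>
        linarith [Real.exp_pos y, Real.exp_pos (-y)]
    have h3 : y ^ 2 ≤ 2 * (Real.exp y + Real.exp (-y)) := by
      rw [sq_abs] at h1; linarith [abs_nonneg y]
    rw [neg_mul, ← hy, hξ, mul_pow]
    nlinarith [sq_nonneg a]
  have hsum : Integrable
      (fun ω => 2 * a ^ 2 * (Real.exp (a⁻¹ * ξ ω) + Real.exp (-a⁻¹ * ξ ω))) P :=
    (i1.add i2).const_mul _
  have hsq : Integrable (fun ω => ξ ω ^ 2) P :=
    hsum.mono' (hm.pow 2) (ae_of_all _ fun ω => by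
      rw [Real.norm_of_nonneg (sq_nonneg _)]; exact hle ω)
  have hL : MemLp ξ 2 P := (memLp_two_iff_integrable_sq hm).2 hsq
  have hint : ∫ ω, ξ ω ^ 2 ∂P ≤ (2 * Real.sqrt (Real.exp (vphi 1)) * a) ^ 2 := by
    refine (integral_mono hsq hsum hle).trans ?_
    rw [integral_const_mul, integral_add i1 i2, mul_pow, mul_pow,
      Real.sq_sqrt (Real.exp_pos _).le]
    nlinarith [sq_nonneg a]
  rw [hL.eLpNorm_eq_integral_rpow_norm two_ne_zero ENNReal.ofNat_ne_top]
  refine ENNReal.ofReal_le_ofReal ?_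
  have : ∫ ω, ‖ξ ω‖ ^ (2 : ENNReal).toReal ∂P = ∫ ω, ξ ω ^ 2 ∂P := by
    refine integral_congr_ae (ae_of_all _ fun ω => ?_)
    simp
  rw [this, ENNReal.toReal_ofNat, ← one_div, ← Real.sqrt_eq_rpow]
  exact Real.sqrt_le_iff.2 ⟨by positivity, hint⟩

theorem ExpMomentBound.eLpNorm_le_tau (hv : IsOrliczNFunction vphi) {a : ℝ} (ha : 0 ≤ a)
    (hm : AEStronglyMeasurable ξ P) (h : ExpMomentBound vphi P ξ a) :
    MemLp ξ 2 P ∧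
      (eLpNorm ξ 2 P).toReal ≤ 2 * Real.sqrt (Real.exp (vphi 1)) * tau vphi P ξ := by
  set C := 2 * Real.sqrt (Real.exp (vphi 1)) with hC
  have hCpos : 0 < C := by positivity
  -- The constant a may be 0, while the L₂ bound needs a positive one; a + 1 serves.
  have hfin : eLpNorm ξ 2 P < ⊤ :=
    ((h.mono hv ha (le_add_of_nonneg_right zero_le_one)).eLpNorm_le hv (by positivity) hm).trans_lt
      ENNReal.ofReal_lt_top
  refine ⟨⟨hm, hfin⟩, ?_⟩
  rw [mul_comm, ← div_le_iff₀ hCpos]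
  refine le_of_forall_gt_imp_ge_of_dense fun r hr => ?_
  obtain ⟨b, ⟨hb0, hb⟩, hbr⟩ := exists_lt_of_csInf_lt
    (s := {a : ℝ | 0 ≤ a ∧ ExpMomentBound vphi P ξ a}) ⟨a, ha, h⟩ hr
  have hr0 : 0 < r := hb0.trans_lt hbr
  rw [div_le_iff₀ hCpos, mul_comm]
  exact ENNReal.toReal_le_of_le_ofReal (by positivity)
    ((hb.mono hv hb0 hbr.le).eLpNorm_le hv hr0 hm)

theorem eLpNorm_ofReal (ξ : Ω → ℝ) : eLpNorm (fun ω => (ξ ω : ℂ)) 2 P = eLpNorm ξ 2 P :=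
  eLpNorm_congr_norm_ae (ae_of_all _ fun ω => by simp)

/-- A bounded `τ`-continuous process is a bounded continuous curve in `L₂`. -/
theorem exists_continuous_curve (hv : IsOrliczNFunction vphi) {X : ℝ → Ω → ℝ}
    (hX : IsSubPhiProcess vphi P X) (hXc : TauContinuous vphi P X) :
    ∃ Y : ℝ → Lp ℂ 2 P, (∀ t, Y t =ᵐ[P] fun ω => (X t ω : ℂ)) ∧ Continuous Y ∧
      ∃ M, ∀ t, ‖Y t‖ ≤ M := by
  obtain ⟨hsub, B, hB⟩ := hX
  have hm : ∀ t, AEStronglyMeasurable (X t) P := fun t => (hsub t).1.1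
  have hb : ∀ t, MemLp (X t) 2 P ∧ (eLpNorm (X t) 2 P).toReal
      ≤ 2 * Real.sqrt (Real.exp (vphi 1)) * tau vphi P (X t) := fun t => by
    obtain ⟨r, hr, h⟩ := (hsub t).2.2
    exact h.eLpNorm_le_tau hv hr (hm t)
  have hL : ∀ t, MemLp (fun ω => (X t ω : ℂ)) 2 P := fun t => (hb t).1.ofReal
  refine ⟨fun t => (hL t).toLp, fun t => (hL t).coeFn_toLp, ?_,
    2 * Real.sqrt (Real.exp (vphi 1)) * B, fun t => ?_⟩
  · refine continuous_iff_continuousAt.2 fun t₀ => ?_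
    rw [ContinuousAt, tendsto_iff_norm_sub_tendsto_zero]
    have h0 := (hXc t₀).const_mul (2 * Real.sqrt (Real.exp (vphi 1)))
    rw [mul_zero] at h0
    refine squeeze_zero (fun _ => norm_nonneg _) (fun t => ?_) h0
    obtain ⟨r, hr, h⟩ := (hsub t).2.2
    obtain ⟨s, hs, h'⟩ := (hsub t₀).2.2
    -- The size of this constant is immaterial: it only makes the infimum defining `tau` of the
    -- increment run over a nonempty set.
    have hd := (h.mono hv hr (le_max_left r s)).sub hv (hm t) (hm t₀)
      (h'.mono hv hs (le_max_right r s))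
    rw [← MemLp.toLp_sub, Lp.norm_toLp]
    have e : eLpNorm ((fun ω => (X t ω : ℂ)) - fun ω => (X t₀ ω : ℂ)) 2 P
        = eLpNorm (fun ω => X t ω - X t₀ ω) 2 P := by
      rw [← eLpNorm_ofReal]
      congr 1
      ext ω
      simp
    rw [e]
    exact (hd.eLpNorm_le_tau hv (by positivity) ((hm t).sub (hm t₀))).2
  · rw [Lp.norm_toLp, eLpNorm_ofReal]
    refine (hb t).2.trans ?_
    gcongr
    exact hB ⟨t, rfl⟩

/-- Mean-square coefficients are Bochner integrals of the associated curve in `L₂`. -/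
theorem isCoefficient_iff {X : ℝ → Ω → ℝ} {Y : ℝ → Lp ℂ 2 P} {M : ℝ} {g : ℝ → ℂ} {ζ : Ω → ℂ}
    (hXY : ∀ t, Y t =ᵐ[P] fun ω => (X t ω : ℂ)) (hY : Continuous Y) (hM : ∀ t, ‖Y t‖ ≤ M)
    (hg : Integrable g) :
    IsCoefficient P X g ζ ↔ ((∫ t, conj (g t) • Y t : Lp ℂ 2 P) : Ω → ℂ) =ᵐ[P] ζ := by
  have hae : ∀ t, (conj (g t) • Y t : Lp ℂ 2 P) =ᵐ[P]
      fun ω => (X t ω : ℂ) * (starRingEnd ℂ) (g t) := fun t => by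
    filter_upwards [Lp.coeFn_smul (conj (g t)) (Y t), hXY t] with ω h1 h2
    rw [h1, Pi.smul_apply, h2, smul_eq_mul, mul_comm]
  constructor
  · rintro ⟨F, hF, -, h⟩
    -- The integrand is forced: at each t, almost sure equality determines the element of L₂.
    have : F = fun t => conj (g t) • Y t :=
      funext fun t => Lp.ext ((hF t).trans (hae t).symm)
    rwa [this] at h
  · intro h
    refine ⟨fun t => conj (g t) • Y t, hae, ?_, h⟩
    simpa using integrable_conj_comp_smul hg hY hM 0

end Probability


/-! ### Truncation and telescoping -/

section Convergence

variable {E : Type*} [NormedAddCommGroup E]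

theorem exists_forall_dist_sum_Icc_lt {f : ℤ → E} {s : E} (hf : HasSum f s) {ε : ℝ} (hε : 0 < ε) :
    ∃ K : ℕ, ∀ k ≥ K, dist (∑ i ∈ Finset.Icc (-(k : ℤ)) k, f i) s < ε :=
  Metric.tendsto_atTop.1 (hf.comp Finset.tendsto_Icc_neg) ε hε

/-- A series of doubly infinite series, truncated at each level, in the product order. -/
theorem tendsto_truncated {f : ℤ → E} {g : ℕ → ℤ → E} {s x : E} {d : ℕ → E} (hf : HasSum f s)
    (hg : ∀ j, HasSum (g j) (d j))
    (hx : Tendsto (fun n : ℕ => s + ∑ j ∈ Finset.range n, d j) atTop (𝓝 x)) :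
    Tendsto (fun q : ℕ × ℕ × (ℕ → ℕ) => ∑ k ∈ Finset.Icc (-(q.2.1 : ℤ)) q.2.1, f k +
      ∑ j ∈ Finset.range q.1, ∑ k ∈ Finset.Icc (-(q.2.2 j : ℤ)) (q.2.2 j), g j k) atTop (𝓝 x) := by
  refine Metric.tendsto_atTop.2 fun ε hε => ?_
  obtain ⟨N, hN⟩ := Metric.tendsto_atTop.1 hx (ε / 4) (by positivity)
  obtain ⟨K, hK⟩ := exists_forall_dist_sum_Icc_lt hf (ε := ε / 4) (by positivity)
  -- The geometric tolerances add up to at most ε/2 whatever the number of levels, so the thresholds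
  -- do not depend on n.
  choose L hL using fun j => exists_forall_dist_sum_Icc_lt (hg j)
    (ε := ε / 4 * (1 / 2) ^ j) (by positivity)
  refine ⟨(N, K, L), fun q hq => ?_⟩
  obtain ⟨hq1, hq2, hq3⟩ := hq
  have h1 := hN q.1 hq1
  have h2 := hK q.2.1 hq2
  have h3 : dist (∑ j ∈ Finset.range q.1, ∑ k ∈ Finset.Icc (-(q.2.2 j : ℤ)) (q.2.2 j), g j k)
      (∑ j ∈ Finset.range q.1, d j) ≤ ε / 4 * 2 := by
    refine (dist_sum_sum_le_of_le _ fun j _ => (hL j _ (hq3 j)).le).trans ?_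
    rw [← Finset.mul_sum]
    gcongr
    exact sum_geometric_two_le _
  have h4 := dist_add_add_le (∑ k ∈ Finset.Icc (-(q.2.1 : ℤ)) q.2.1, f k)
    (∑ j ∈ Finset.range q.1, ∑ k ∈ Finset.Icc (-(q.2.2 j : ℤ)) (q.2.2 j), g j k) s
    (∑ j ∈ Finset.range q.1, d j)
  have h5 := dist_triangle (∑ k ∈ Finset.Icc (-(q.2.1 : ℤ)) q.2.1, f k +
    ∑ j ∈ Finset.range q.1, ∑ k ∈ Finset.Icc (-(q.2.2 j : ℤ)) (q.2.2 j), g j k)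
    (s + ∑ j ∈ Finset.range q.1, d j) x
  linarith

variable [NormedSpace ℂ E] [CompleteSpace E] {phi psi : ℝ → ℂ} {w : ℤ → ℝ}

theorem HasWienerBound.summable_smul_shiftCoeff {f : ℝ → ℂ} {w : ℤ → ℝ} (hw : HasWienerBound f w)
    (hf : Integrable f) {Y : ℝ → E} {M : ℝ} (hM : ∀ s, ‖Y s‖ ≤ M) (x : ℝ) :
    Summable fun k : ℤ => f (x - k) • shiftCoeff f Y k := by
  refine .of_norm_bounded ((hw.summable_norm x).mul_right (M * ∫ s, ‖f s‖)) fun k => ?_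
  rw [norm_smul]
  gcongr
  exact norm_shiftCoeff_le hf hM k

/-- Passing to the next scale amounts to adding the details. -/
theorem IsRefinable.projection_add_detail {h : ℤ → ℂ} (hR : IsRefinable phi w h)
    (hpsi : ∀ x, HasSum (fun l : ℤ => 2 * mirror h l * phi (2 * x - l)) (psi x))
    {Y : ℝ → E} {M : ℝ} (hY : Continuous Y) (hM : ∀ s, ‖Y s‖ ≤ M) (x : ℝ) :
    ∑' k : ℤ, phi (x - k) • shiftCoeff phi Y k + ∑' k : ℤ, psi (x - k) • shiftCoeff psi Y k
      = ∑' k : ℤ, phi (2 * x - k) • shiftCoeff phi (fun s => Y (s / 2)) k := by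
  have key := filterBank_reconstruction (a := fun p : ℤ => phi (2 * x - p))
    (ζ := fun p => shiftCoeff phi (fun s => Y (s / 2)) p) hR.summable hR.isQMF
    (hR.bound.summable_norm (2 * x))
    (fun k => norm_shiftCoeff_le hR.integrable (fun s => hM (s / 2)) k)
  have e : ∀ {f : ℝ → ℂ} {b : ℤ → ℂ} (_ : Summable fun l => ‖b l‖)
      (_ : ∀ x, HasSum (fun l : ℤ => 2 * b l * phi (2 * x - l)) (f x)) (k : ℤ),
      (∑' l : ℤ, 2 * b l * phi (2 * x - (2 * k + l : ℤ))) •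
        (∑' l : ℤ, conj (b l) • shiftCoeff phi (fun s => Y (s / 2)) (2 * k + l))
        = f (x - k) • shiftCoeff f Y k := by
    intro f b hb href k
    rw [(hasSum_shiftCoeff hb hR.integrable href hY hM k).tsum_eq, ← (href (x - k)).tsum_eq]
    congr 1
    refine tsum_congr fun l => ?_
    congr 2
    push_cast; ring
  simp only [e hR.summable hR.refine_eq, e (summable_norm_mirror hR.summable) hpsi] at key
  exact key

theorem IsRefinable.projection_eq_sum {h : ℤ → ℂ} (hR : IsRefinable phi w h)
    (hpsi : ∀ x, HasSum (fun l : ℤ => 2 * mirror h l * phi (2 * x - l)) (psi x))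
    {Y : ℝ → E} {M : ℝ} (hY : Continuous Y) (hM : ∀ s, ‖Y s‖ ≤ M) (t : ℝ) (n : ℕ) :
    ∑' k : ℤ, phi (2 ^ n * t - k) • shiftCoeff phi (fun s => Y (s / 2 ^ n)) k
      = ∑' k : ℤ, phi (t - k) • shiftCoeff phi Y k + ∑ j ∈ Finset.range n,
        ∑' k : ℤ, psi (2 ^ j * t - k) • shiftCoeff psi (fun s => Y (s / 2 ^ j)) k := by
  induction n with
  | zero => simp
  | succ n ih =>
    rw [Finset.sum_range_succ, ← add_assoc, ← ih,
      hR.projection_add_detail hpsi (Y := fun s => Y (s / 2 ^ n)) (hY.comp (by fun_prop))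
        (fun s => hM _)]
    simp only [pow_succ', div_div, mul_assoc]

end Convergence

/-! ### Normalised dilations and the deterministic expansion -/

theorem dilate_natCast (f : ℝ → ℂ) (j : ℕ) (k : ℤ) (x : ℝ) :
    dilate f j k x = (((2 : ℝ) ^ ((j : ℝ) / 2) : ℝ) : ℂ) * f (2 ^ j * x - k) := by
  simp [dilate]

theorem integrable_dilate {f : ℝ → ℂ} (hf : Integrable f) (j : ℕ) (k : ℤ) :
    Integrable (dilate f j k) := by
  have := ((hf.comp_sub_right (k : ℝ)).comp_mul_left' (pow_ne_zero j two_ne_zero)).const_mul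
    (((2 : ℝ) ^ ((j : ℝ) / 2) : ℝ) : ℂ)
  exact this.congr (ae_of_all _ fun x => (dilate_natCast f j k x).symm)

/-- A normed group carries at most one structure of a real normed space. -/
theorem normedSpace_real_eq {E : Type*} [NormedAddCommGroup E] (i j : NormedSpace ℝ E) : i = j := by
  have hc : ∀ i : NormedSpace ℝ E, ContinuousSMul ℝ E := fun i => inferInstance
  have h : i.toModule = j.toModule := by
    refine Module.ext' _ _ fun r x => ?_
    exact @map_real_smul E _ i.toModule _ (hc i) E _ j.toModule _ (hc j) _ (E →+ E) _ _
      (AddMonoidHom.id E) continuous_id r x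
  cases i; cases j
  cases h
  rfl

/-- The two factors 2^{j/2} multiply to 2^j, which the Jacobian of u = 2^j s cancels. -/
theorem dilate_smul_integral {E : Type*} [NormedAddCommGroup E] [i : NormedSpace ℝ E]
    [NormedSpace ℂ E] (f : ℝ → ℂ) (Y : ℝ → E) (j : ℕ) (k : ℤ) (t : ℝ) :
    dilate f j k t • ∫ s, conj (dilate f j k s) • Y s
      = f (2 ^ j * t - k) • shiftCoeff f (fun s => Y (s / 2 ^ j)) k := by
  -- The integral on the left may use any real structure on E, while `shiftCoeff` uses the
  -- restriction of the complex one.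
  obtain rfl := normedSpace_real_eq i NormedSpace.complexToReal
  set a : ℝ := (2 : ℝ) ^ ((j : ℝ) / 2) with ha
  have haa : a * a = 2 ^ j := by
    rw [ha, ← Real.rpow_add two_pos, add_halves, Real.rpow_natCast]
  have hscale := Measure.integral_comp_mul_left
    (fun u : ℝ => conj (f (u - k)) • Y (u / 2 ^ j)) (2 ^ j)
  have e : ∀ s, conj (dilate f j k s) • Y s
      = (a : ℂ) • (conj (f (2 ^ j * s - k)) • Y (2 ^ j * s / 2 ^ j)) := fun s => by
    rw [dilate_natCast, map_mul, Complex.conj_ofReal, smul_smul,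
      mul_div_cancel_left₀ _ (pow_ne_zero j two_ne_zero)]
  simp only [e]
  rw [integral_smul, hscale, dilate_natCast, ← ha, abs_of_pos (by positivity), ← Complex.coe_smul,
    smul_smul, smul_smul, shiftCoeff]
  congr 1
  have h2 : (a : ℂ) * a = 2 ^ j := by exact_mod_cast haa
  have h3 : ((2 : ℂ) ^ j) ≠ 0 := pow_ne_zero j two_ne_zero
  push_cast
  rw [show (a : ℂ) * f (2 ^ j * t - k) * a * ((2 : ℂ) ^ j)⁻¹
    = a * a * ((2 : ℂ) ^ j)⁻¹ * f (2 ^ j * t - k) by ring, h2, mul_inv_cancel₀ h3, one_mul]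

/-- The truncated wavelet expansions of a bounded continuous curve converge pointwise. -/
theorem IsRefinable.tendsto_expansion {E : Type*} [NormedAddCommGroup E] [NormedSpace ℝ E]
    [NormedSpace ℂ E] [CompleteSpace E] {phi psi : ℝ → ℂ} {w w' : ℤ → ℝ} {h : ℤ → ℂ}
    (hR : IsRefinable phi w h)
    (href : ∀ x, HasSum (fun l : ℤ => 2 * mirror h l * phi (2 * x - l)) (psi x))
    (hpsi : Integrable psi) (hw' : HasWienerBound psi w') {Y : ℝ → E} {M : ℝ} (hY : Continuous Y)
    (hM : ∀ s, ‖Y s‖ ≤ M) (t : ℝ) :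
    Tendsto (fun q : ℕ × ℕ × (ℕ → ℕ) => ∑ k ∈ Finset.Icc (-(q.2.1 : ℤ)) q.2.1,
        dilate phi (0 : ℕ) k t • (∫ s, conj (dilate phi (0 : ℕ) k s) • Y s) +
      ∑ j ∈ Finset.range q.1, ∑ k ∈ Finset.Icc (-(q.2.2 j : ℤ)) (q.2.2 j),
        dilate psi j k t • ∫ s, conj (dilate psi j k s) • Y s) atTop (𝓝 (Y t)) := by
  simp only [dilate_smul_integral]
  have hlim := hR.tendsto_projection hY hM t
  simp only [hR.projection_eq_sum href hY hM] at hlim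
  refine tendsto_truncated ?_ (fun j =>
    (hw'.summable_smul_shiftCoeff hpsi (fun s => hM (s / 2 ^ j)) (2 ^ j * t)).hasSum) hlim
  simpa using (hR.bound.summable_smul_shiftCoeff hR.integrable hM t).hasSum

end SubPhiWavelet

/-! ### Transfer from the L₂ curve to the random variables -/

theorem mainTheorem7 {Ω : Type*} [MeasurableSpace Ω] (P : Measure Ω) [IsProbabilityMeasure P]
    (vphi : ℝ → ℝ) (hQ : SubPhiWavelet.AssumptionQ vphi)
    (X : ℝ → Ω → ℝ) (hX : SubPhiWavelet.IsSubPhiProcess vphi P X)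
    (hXcont : SubPhiWavelet.TauContinuous vphi P X)
    (phi psi : ℝ → ℂ)
    (hphi : SubPhiWavelet.IsFWavelet phi) (hpsi : SubPhiWavelet.IsMWavelet phi psi)
    (hphi_cont : Continuous phi) (hpsi_cont : Continuous psi)
    (Phi : ℝ → ℝ)
    (hphi_S : SubPhiWavelet.AssumptionS phi Phi) (hpsi_S : SubPhiWavelet.AssumptionS psi Phi)
    (c : ℝ → ℝ) (hc_even : ∀ x, c (-x) = c x) (hc_mono : MonotoneOn c (Set.Ici 0))
    (hc_zero : 1 < c 0)
    (A : ℝ → ℝ) (hA : ∀ a, 0 < a → 0 < A a) (x₀ : ℝ)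
    (hcA : ∀ a, 0 < a → ∀ x, x₀ ≤ x → c (a * x) ≤ c x * A a)
    (hcPhi : Integrable (fun x : ℝ => c x * Phi |x|) volume)
    (hτ : ∀ t, SubPhiWavelet.tau vphi P (X t) ≤ c t) :
    (∀ k : ℤ, ∃ ξ : Ω → ℂ, SubPhiWavelet.IsCoefficient P X (SubPhiWavelet.dilate phi 0 k) ξ) ∧
    (∀ (j : ℕ) (k : ℤ), ∃ η : Ω → ℂ,
      SubPhiWavelet.IsCoefficient P X (SubPhiWavelet.dilate psi j k) η) ∧
    ∀ (ξ : ℤ → Ω → ℂ) (η : ℕ → ℤ → Ω → ℂ),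
      (∀ k, SubPhiWavelet.IsCoefficient P X (SubPhiWavelet.dilate phi 0 k) (ξ k)) →
      (∀ (j : ℕ) (k : ℤ),
        SubPhiWavelet.IsCoefficient P X (SubPhiWavelet.dilate psi j k) (η j k)) →
      (∀ (n k₀' : ℕ) (κ : ℕ → ℕ) (t : ℝ),
        MemLp (SubPhiWavelet.approximant phi psi ξ η n k₀' κ t) 2 P) ∧
      ∀ t : ℝ, MemLp (X t) 2 P ∧
        Tendsto
          (fun q : ℕ × ℕ × (ℕ → ℕ) =>
            eLpNorm (fun ω => SubPhiWavelet.approximant phi psi ξ η q.1 q.2.1 q.2.2 t ω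
              - (X t ω : ℂ)) 2 P)
          atTop (𝓝 0) := by
  open SubPhiWavelet ComplexConjugate in
  obtain ⟨Y, hXY, hY, M, hM⟩ := exists_continuous_curve hQ.1 hX hXcont
  obtain ⟨w, hw⟩ := hphi_S.exists_wienerBound hphi_cont
  obtain ⟨w', hw'⟩ := hpsi_S.exists_wienerBound hpsi_cont
  obtain ⟨h, hR, href⟩ := exists_isRefinable hphi hpsi hphi_cont hpsi_cont hw
  have hphii := hphi.integrable
  have hpsii := hpsi.2.1
  have hiff : ∀ {f : ℝ → ℂ} (_ : Integrable f) (j : ℕ) (k : ℤ) (ζ : Ω → ℂ),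
      IsCoefficient P X (dilate f j k) ζ ↔
        ((∫ t, conj (dilate f j k t) • Y t : Lp ℂ 2 P) : Ω → ℂ) =ᵐ[P] ζ :=
    fun hf j k ζ => isCoefficient_iff hXY hY hM (integrable_dilate hf j k)
  refine ⟨fun k => ⟨_, (hiff hphii 0 k _).2 EventuallyEq.rfl⟩,
    fun j k => ⟨_, (hiff hpsii j k _).2 EventuallyEq.rfl⟩, fun ξ η hξ hη => ?_⟩
  have hξ' := fun k => (hiff hphii 0 k _).1 (hξ k)
  have hη' := fun j k => (hiff hpsii j k _).1 (hη j k)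
  set U : ℝ → ℤ → Lp ℂ 2 P := fun t k =>
    dilate phi (0 : ℕ) k t • ∫ s, conj (dilate phi (0 : ℕ) k s) • Y s with hU
  set V : ℝ → ℕ → ℤ → Lp ℂ 2 P := fun t j k =>
    dilate psi j k t • ∫ s, conj (dilate psi j k s) • Y s with hV
  have happ : ∀ (n k₀ : ℕ) (κ : ℕ → ℕ) (t : ℝ),
      (∑ k ∈ Finset.Icc (-(k₀ : ℤ)) k₀, U t k + ∑ j ∈ Finset.range n,
        ∑ k ∈ Finset.Icc (-(κ j : ℤ)) (κ j), V t j k : Lp ℂ 2 P) =ᵐ[P]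
      approximant phi psi ξ η n k₀ κ t := by
    intro n k₀ κ t
    have hU' : ∀ k, U t k =ᵐ[P] fun ω => ξ k ω * dilate phi 0 k t := fun k => by
      filter_upwards [Lp.coeFn_smul (dilate phi (0 : ℕ) k t)
        (∫ s, conj (dilate phi (0 : ℕ) k s) • Y s : Lp ℂ 2 P), hξ' k] with ω h1 h2
      simp only [hU]
      rw [h1, Pi.smul_apply, h2, smul_eq_mul, mul_comm]
      rfl
    have hV' : ∀ j k, V t j k =ᵐ[P] fun ω => η j k ω * dilate psi j k t := fun j k => by
      filter_upwards [Lp.coeFn_smul (dilate psi j k t)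
        (∫ s, conj (dilate psi j k s) • Y s : Lp ℂ 2 P), hη' j k] with ω h1 h2
      simp only [hV]
      rw [h1, Pi.smul_apply, h2, smul_eq_mul, mul_comm]
    have hsum := Lp.coeFn_fun_finsetSum (Finset.range n) fun j =>
      ∑ k ∈ Finset.Icc (-(κ j : ℤ)) (κ j), V t j k
    have hsum' := ae_all_iff.2 fun j =>
      Lp.coeFn_fun_finsetSum (Finset.Icc (-(κ j : ℤ)) (κ j)) fun k => V t j k
    filter_upwards [Lp.coeFn_add (∑ k ∈ Finset.Icc (-(k₀ : ℤ)) k₀, U t k)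
      (∑ j ∈ Finset.range n, ∑ k ∈ Finset.Icc (-(κ j : ℤ)) (κ j), V t j k),
      Lp.coeFn_fun_finsetSum (Finset.Icc (-(k₀ : ℤ)) k₀) fun k => U t k, hsum, hsum',
      ae_all_iff.2 hU', ae_all_iff.2 fun j => ae_all_iff.2 (hV' j)] with ω h1 h2 h3 h4 h5 h6
    rw [h1, Pi.add_apply, h2, h3]
    simp only [h4, h5, h6, approximant]
  refine ⟨fun n k₀ κ t => (memLp_congr_ae (happ n k₀ κ t)).1 (Lp.memLp _), fun t => ⟨?_, ?_⟩⟩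
  · have := (memLp_congr_ae (hXY t)).1 (Lp.memLp _)
    simpa using this.re
  -- The extended distance in `Lp` is the `eLpNorm` of the difference, so only representatives
  -- remain to be matched.
  · have hed := tendsto_iff_edist_tendsto_0.1 (hR.tendsto_expansion href hpsii hw' hY hM t)
    refine hed.congr fun q => ?_
    rw [Lp.edist_def]
    refine eLpNorm_congr_ae ?_
    filter_upwards [happ q.1 q.2.1 q.2.2 t, hXY t] with ω h1 h2
    rw [Pi.sub_apply, h1, h2]
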